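/- Conventions. For a complex matrix $M$ with $n$ columns and $k\in\{1,\dots,n\}$, the rank expansion $\tilde\sigma_M(k)$ is the minimum rank of a submatrix formed by $k$ different columns of $M$. For $D\subseteq[0,\infty)$, a function $\sigma$ is a *rank expansion lower bound for $M$ on $D$* if it is continuous, nonnegative and (weakly) increasing on $D$ and $\sigma(k)\le\tilde\sigma_M(k)$ for every $k\in\{1,\dots,n\}\cap D$. Theorem. Let $A\in\mathbb C^{m_A\times n_A}$, $B\in\mathbb C^{m_B\times n_B}$ and $C=A\otimes B$. Let $\sigma_A$ and $\sigma_B$ be concave rank expansion lower bounds for $A$ on $[0,n_A]$ and for $B$ on $[0,n_B]$, respectively, with $\sigma_A(0)=\sigma_B(0)=0$. Put $r_A=\sigma_A(n_A)$, $r_B=\sigma_B(n_B)$, $d_A=\sup\{x\in[0,n_A]:\sigma_A(x)\le1\}$ and $d_B=\sup\{x\in[0,n_B]:\sigma_B(x)\le1\}$. For $k\in[0,n_An_B]$ define $$R_C(k)=\min\{\sigma_A(k_A)\,\sigma_B(k_B)\;:\;k_A\in[d_A,n_A],\ k_B\in[d_B,n_B],\ k_Ak_B\ge k\},$$ $$L_C(k)=\min\{\sigma_A(k_A)\,r_B+\sigma_B(k_B)\,r_A-\sigma_A(k_A)\,\sigma_B(k_B)\;:\;k_A\in[0,n_A],\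 k_B\in[0,n_B],\ k_An_B+k_Bn_A-k_Ak_B=k\},$$ and extend both functions to $k>n_An_B$ by their values at $n_An_B$. Then: 1. the minima defining $R_C(k)$ and $L_C(k)$ exist for every $k\in[0,n_An_B]$; 2. $\sigma_C(k)=\min\{L_C(k),R_C(k)\}$ is a rank expansion lower bound for $C$ on $[0,\infty)$; 3. $R_C$ is a rank expansion lower bound for $C$ on the set of all $k\ge0$ with $R_C(k)\le\max\{r_A,r_B\}$. In particular $R_C(k)\le\tilde\sigma_C(k)$ for every $k\in\{1,\dots,n_An_B\}$ with $R_C(k)\le\max\{r_A,r_B\}$. -/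

import Mathlib

open Set
open scoped Kronecker

noncomputable section

/-- The rank expansion of a complex matrix `A`: the minimum rank of a matrix formed by `k`
different columns of `A`.  An embedding `e : Fin k ↪ κ` selects the columns, so that
`A.submatrix id e` is `A * P` for the matrix `P` formed by the corresponding `k` different
columns of the identity matrix. It is used for `1 ≤ k ≤ card κ`, where such selections exist. -/
def rankExpansion {ι κ : Type*} [Fintype κ] (A : Matrix ι κ ℂ) (k : ℕ) : ℕ :=
  sInf {r : ℕ | ∃ e : Fin k ↪ κ, r = (A.submatrix id e).rank}

/-- `σ` is a rank expansion lower bound for `A` on the domain `D ⊆ [0, ∞)`: it is continuous,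
nonnegative and (weakly) increasing on `D`, and lies below the rank expansion at all
`k ∈ {1, …, n} ∩ D`, where `n` is the number of columns of `A`.
For `D = [0, ∞)` this is the notion of a rank expansion lower bound on the nonnegative reals. -/
structure IsRankExpansionLowerBoundOn {ι κ : Type*} [Fintype κ] (A : Matrix ι κ ℂ)
    (D : Set ℝ) (σ : ℝ → ℝ) : Prop where
  continuousOn : ContinuousOn σ D
  nonneg : ∀ x ∈ D, 0 ≤ σ x
  monotoneOn : MonotoneOn σ D
  le_rankExpansion : ∀ k : ℕ, 1 ≤ k → k ≤ Fintype.card κ → (k : ℝ) ∈ D →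
    σ k ≤ (rankExpansion A k : ℝ)

/-- The pseudoinverse `σ†(x) = sup {k : σ k ≤ x}` of an increasing function `σ` with
domain `[0, n]`. -/
def pseudoinverse (n : ℕ) (σ : ℝ → ℝ) (x : ℝ) : ℝ :=
  sSup {k : ℝ | k ∈ Icc (0 : ℝ) n ∧ σ k ≤ x}

/-- The values minimised in the rectangle bound `R_C(k)`. -/
def rectValues (nA nB : ℕ) (σA σB : ℝ → ℝ) (k : ℝ) : Set ℝ :=
  {v : ℝ | ∃ kA ∈ Icc (pseudoinverse nA σA 1) (nA : ℝ),
    ∃ kB ∈ Icc (pseudoinverse nB σB 1) (nB : ℝ),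
      k ≤ kA * kB ∧ v = σA kA * σB kB}

/-- The rectangle bound `R_C(k)`. -/
def rectBound (nA nB : ℕ) (σA σB : ℝ → ℝ) (k : ℝ) : ℝ :=
  sInf (rectValues nA nB σA σB k)

/-- The values minimised in the L-shaped bound `L_C(k)`; here `r_A = σA nA`, `r_B = σB nB`. -/
def lShapeValues (nA nB : ℕ) (σA σB : ℝ → ℝ) (k : ℝ) : Set ℝ :=
  {v : ℝ | ∃ kA ∈ Icc (0 : ℝ) nA, ∃ kB ∈ Icc (0 : ℝ) nB,
      kA * nB + kB * nA - kA * kB = k ∧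
      v = σA kA * σB nB + σB kB * σA nA - σA kA * σB kB}

/-- The L-shaped bound `L_C(k)`. -/
def lShapeBound (nA nB : ℕ) (σA σB : ℝ → ℝ) (k : ℝ) : ℝ :=
  sInf (lShapeValues nA nB σA σB k)

/-- The extension of a function on `[0, N]` to `[0, ∞)` by its value at `N`. -/
def constExtend (N : ℝ) (σ : ℝ → ℝ) : ℝ → ℝ := fun k => σ (min k N)

end

/-! Regard a set S of k columns of A ⊗ B as a set of pairs (i, j), and order the columns of A by
decreasing size of their fibres in S. When a column of A is added, a functional vanishing on the
earlier columns but not on the new one shows that the rank grows by at least the rank increment of A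
times the rank of the fibre in B (`finrank_colSpan_kronecker_step`). Summation by parts replaces
these ranks by σ_A and σ_B. The rank is thus at least the dσ_A ⊗ dσ_B measure of a staircase of area
at least k. Since a nonempty set of columns has rank at least σ(d) (`bound_max_le_finrank_colSpan`),
the staircase may be enlarged until its first width is at least d_A and its last height at least
d_B.

It remains to minimise the measure of such staircases for a given area. If two heights, two widths,
or the height of one step and the width of another vary with the area fixed, the measure is concave
along the motion, so one end of the motion is no worse (`exists_exchange`, `exists_exchange_mixed`).
At an end a step disappears or a side becomes full. This leaves three steps (`exists_three_steps`),
and then a rectangle or an L-shape (`rect_or_lShape_of_three_steps`).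

For R_C alone, the exchange is stopped when the first step reaches full height. Its width x₁ is at
least d_A, so either σ_A(x₁) ≥ 1 and this step alone has measure at least r_B, or x₁ = n_A and the
staircase is a rectangle. Transposing gives r_A in the same way. Hence a rank not bounded below by a
rectangle is at least max(r_A, r_B), which suffices wherever R_C is at most this maximum. -/

/-! ### Exchange arguments for concave functions. -/

/-- A weighted sum of two concave functions is at most its value at an intermediate point at one
of the two ends of a segment. -/
lemma weighted_concave_endpoint_le {s t : Set ℝ} {f g : ℝ → ℝ} (hf : ConcaveOn ℝ s f)
    (hg : ConcaveOn ℝ t g) {α β a b p q p₁ q₁ p₂ q₂ : ℝ} (hα : 0 ≤ α) (hβ : 0 ≤ β)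
    (ha : 0 ≤ a) (hb : 0 ≤ b) (hab : a + b = 1) (hp₁ : p₁ ∈ s) (hp₂ : p₂ ∈ s)
    (hq₁ : q₁ ∈ t) (hq₂ : q₂ ∈ t) (hp : a * p₁ + b * p₂ = p) (hq : a * q₁ + b * q₂ = q) :
    α * f p₁ + β * g q₁ ≤ α * f p + β * g q ∨ α * f p₂ + β * g q₂ ≤ α * f p + β * g q := by
  have h1 := hf.2 hp₁ hp₂ ha hb hab
  have h2 := hg.2 hq₁ hq₂ ha hb hab
  simp only [smul_eq_mul, hp, hq] at h1 h2
  have h1' := mul_le_mul_of_nonneg_left h1 hα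
  have h2' := mul_le_mul_of_nonneg_left h2 hβ
  by_contra! h
  obtain ⟨h3, h4⟩ := h
  set V := α * f p + β * g q
  have h3' := mul_le_mul_of_nonneg_left h3.le ha
  have h4' := mul_le_mul_of_nonneg_left h4.le hb
  rcases ha.eq_or_lt with h0 | h0
  · have : b = 1 := by linarith
    subst this; subst h0
    simp only [zero_mul, one_mul, zero_add] at h1' h2'
    linarith
  · have h3'' := mul_lt_mul_of_pos_left h3 h0
    have : a * V + b * V = V := by rw [← add_mul, hab, one_mul]
    have h5 : α * (a * f p₁ + b * f p₂) + β * (a * g q₁ + b * g q₂)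
      = a * (α * f p₁ + β * g q₁) + b * (α * f p₂ + β * g q₂) := by ring
    linarith

/-- Two heights `q ≤ p` of a profile can be changed, keeping the weighted sum `l * p + m * q`
and not increasing the value, until they coincide or one of them reaches a bound. -/
lemma exists_exchange {n : ℝ} {σ : ℝ → ℝ} (hc : ConcaveOn ℝ (Icc 0 n) σ)
    (hm : MonotoneOn σ (Icc 0 n)) {lo hi p q l m α β : ℝ} (hlo : 0 ≤ lo) (hq : lo ≤ q)
    (hqp : q ≤ p) (hp : p ≤ hi) (hhi : hi ≤ n) (hl : 0 ≤ l) (hm0 : 0 ≤ m) (hα : 0 ≤ α)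
    (hβ : 0 ≤ β) :
    ∃ p' q', lo ≤ q' ∧ q' ≤ p' ∧ p' ≤ hi ∧ l * p' + m * q' = l * p + m * q ∧
      α * σ p' + β * σ q' ≤ α * σ p + β * σ q ∧
      ((p' = q' ∧ q ≤ q') ∨ (q' = lo ∧ p ≤ p') ∨ p' = hi) := by
  have mem : ∀ {x}, lo ≤ x → x ≤ hi → x ∈ Icc 0 n := fun h1 h2 =>
    ⟨hlo.trans h1, h2.trans hhi⟩
  -- A height of weight zero can be lowered without changing the weighted sum, and monotonicity
  -- controls the value: `p` drops to `q` here, `q` drops to `lo` in the next case.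
  rcases hl.eq_or_lt with rfl | hl
  · refine ⟨q, q, hq, le_rfl, hqp.trans hp, by ring, ?_, Or.inl ⟨rfl, le_rfl⟩⟩
    have := hm (mem hq (hqp.trans hp)) (mem (hq.trans hqp) hp) hqp
    gcongr
  rcases hm0.eq_or_lt with rfl | hm0
  · refine ⟨p, lo, le_rfl, hq.trans hqp, hp, by ring, ?_, Or.inr (Or.inl ⟨rfl, le_rfl⟩)⟩
    have := hm (mem le_rfl ((hq.trans hqp).trans hp)) (mem hq (hqp.trans hp)) hq
    gcongr
  obtain ⟨t, ht0, htp, htq, hte⟩ : ∃ t, 0 ≤ t ∧ p + m * t ≤ hi ∧ lo ≤ q - l * t ∧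
      (q - l * t = lo ∨ p + m * t = hi) := by
    rcases le_total ((q - lo) / l) ((hi - p) / m) with h | h
    · refine ⟨(q - lo) / l, div_nonneg (by linarith) hl.le, ?_, ?_, Or.inl ?_⟩
      · rw [le_div_iff₀ hm0] at h; linarith
      · rw [mul_div_cancel₀ _ hl.ne']; linarith
      · rw [mul_div_cancel₀ _ hl.ne']; linarith
    · refine ⟨(hi - p) / m, div_nonneg (by linarith) hm0.le, ?_, ?_, Or.inr ?_⟩
      · rw [mul_div_cancel₀ _ hm0.ne']; linarith
      · rw [le_div_iff₀ hl] at h; linarith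
      · rw [mul_div_cancel₀ _ hm0.ne']; linarith
  -- The heights move along `(p + m * s, q - l * s)`. They meet at `s = -u`, and the first bound is
  -- hit at `s = t`; the given point lies between these two ends.
  set u := (p - q) / (l + m) with hu
  have hlm : 0 < l + m := by positivity
  have hu0 : 0 ≤ u := div_nonneg (by linarith) hlm.le
  have hue : u * (l + m) = p - q := div_mul_cancel₀ _ hlm.ne'
  have hlu : 0 ≤ l * u := by positivity
  have hmu : 0 ≤ m * u := by positivity
  have hlt : 0 ≤ l * t := by positivity
  have hmt : 0 ≤ m * t := by positivity
  rcases (add_nonneg hu0 ht0).eq_or_lt with h0 | h0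
  · have hut : u = 0 := by linarith
    have : p = q := by rw [hut] at hue; linarith
    exact ⟨p, q, hq, hqp, hp, rfl, le_rfl, Or.inl ⟨this, le_rfl⟩⟩
  have key := weighted_concave_endpoint_le hc hc (a := t / (u + t)) (b := u / (u + t))
    (p := p) (q := q) (p₁ := p - m * u) (q₁ := q + l * u) (p₂ := p + m * t) (q₂ := q - l * t)
    hα hβ (by positivity) (by positivity) (by field_simp; ring)
    (mem (by nlinarith) (by linarith)) (mem (by linarith) htp)
    (mem (by linarith) (by nlinarith)) (mem htq (by linarith))
    (by field_simp; ring) (by field_simp; ring)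
  rcases key with h | h
  · exact ⟨p - m * u, q + l * u, by linarith, by linarith, by linarith, by ring, h,
      Or.inl ⟨by linarith, by linarith⟩⟩
  · refine ⟨p + m * t, q - l * t, htq, by linarith, htp, by ring, h, Or.inr ?_⟩
    rcases hte with h1 | h1
    · exact Or.inl ⟨h1, by linarith⟩
    · exact Or.inr h1

/-- Two quantities weighed by different concave functions can be changed, keeping the weighted
sum `l * p + m * q` and not increasing the value, until one of them reaches a bound. -/
lemma exists_exchange_mixed {s t : Set ℝ} {f g : ℝ → ℝ} (hf : ConcaveOn ℝ s f)
    (hg : ConcaveOn ℝ t g) {p₀ p₁ q₀ q₁ p q l m α β : ℝ} (hs : Icc p₀ p₁ ⊆ s)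
    (ht : Icc q₀ q₁ ⊆ t) (hp : p ∈ Icc p₀ p₁) (hq : q ∈ Icc q₀ q₁)
    (hl : 0 < l) (hm : 0 < m) (hα : 0 ≤ α) (hβ : 0 ≤ β) :
    ∃ p' ∈ Icc p₀ p₁, ∃ q' ∈ Icc q₀ q₁, l * p' + m * q' = l * p + m * q ∧
      α * f p' + β * g q' ≤ α * f p + β * g q ∧
      (p' = p₀ ∨ p' = p₁ ∨ q' = q₀ ∨ q' = q₁) := by
  have bound : ∀ {p₁ q₀ p q l m : ℝ}, 0 < l → 0 < m → p ≤ p₁ → q₀ ≤ q → ∃ t, 0 ≤ t ∧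
      p + m * t ≤ p₁ ∧ q₀ ≤ q - l * t ∧ (q - l * t = q₀ ∨ p + m * t = p₁) := by
    intro p₁ q₀ p q l m hl hm hp hq
    rcases le_total ((q - q₀) / l) ((p₁ - p) / m) with h | h
    · refine ⟨(q - q₀) / l, div_nonneg (by linarith) hl.le, ?_, ?_, Or.inl ?_⟩
      · rw [le_div_iff₀ hm] at h; linarith
      · rw [mul_div_cancel₀ _ hl.ne']; linarith
      · rw [mul_div_cancel₀ _ hl.ne']; linarith
    · refine ⟨(p₁ - p) / m, div_nonneg (by linarith) hm.le, ?_, ?_, Or.inr ?_⟩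
      · rw [mul_div_cancel₀ _ hm.ne']; linarith
      · rw [le_div_iff₀ hl] at h; linarith
      · rw [mul_div_cancel₀ _ hm.ne']; linarith
  obtain ⟨t, ht0, htp, htq, hte⟩ := bound hl hm hp.2 hq.1
  obtain ⟨u, hu0, huq, hup, hue⟩ := bound hm hl hq.2 hp.1
  have hlu : 0 ≤ l * u := by positivity
  have hmu : 0 ≤ m * u := by positivity
  have hlt : 0 ≤ l * t := by positivity
  have hmt : 0 ≤ m * t := by positivity
  have m1 : p - m * u ∈ Icc p₀ p₁ := ⟨hup, by linarith [hp.2]⟩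
  have m2 : p + m * t ∈ Icc p₀ p₁ := ⟨by linarith [hp.1], htp⟩
  have m3 : q + l * u ∈ Icc q₀ q₁ := ⟨by linarith [hq.1], huq⟩
  have m4 : q - l * t ∈ Icc q₀ q₁ := ⟨htq, by linarith [hq.2]⟩
  rcases (add_nonneg hu0 ht0).eq_or_lt with h0 | h0
  · have htt : t = 0 := by linarith
    rw [htt] at hte
    refine ⟨p, hp, q, hq, rfl, le_rfl, ?_⟩
    rcases hte with h | h
    · exact Or.inr (Or.inr (Or.inl (by linarith)))
    · exact Or.inr (Or.inl (by linarith))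
  have key := weighted_concave_endpoint_le hf hg (a := t / (u + t)) (b := u / (u + t))
    (p := p) (q := q) (p₁ := p - m * u) (q₁ := q + l * u) (p₂ := p + m * t) (q₂ := q - l * t)
    hα hβ (by positivity) (by positivity) (by field_simp; ring)
    (hs m1) (hs m2) (ht m3) (ht m4) (by field_simp; ring) (by field_simp; ring)
  rcases key with h | h
  · refine ⟨_, m1, _, m3, by ring, h, ?_⟩
    tauto
  · refine ⟨_, m2, _, m4, by ring, h, ?_⟩
    tauto

/-! ### Profiles, staircases and the two extremal shapes. -/

/-- A concave increasing function on `[0, n]` vanishing at `0`, with a threshold `d` beyond which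
its values are at least `1` (except possibly at `n`). -/
structure IsProfile (n d : ℝ) (σ : ℝ → ℝ) : Prop where
  d_nonneg : 0 ≤ d
  d_le : d ≤ n
  concave : ConcaveOn ℝ (Icc 0 n) σ
  mono : MonotoneOn σ (Icc 0 n)
  zero : σ 0 = 0
  one_le : ∀ x, d ≤ x → x ≤ n → 1 ≤ σ x ∨ x = n

namespace IsProfile

variable {n d : ℝ} {σ : ℝ → ℝ}

lemma le (h : IsProfile n d σ) {x y : ℝ} (hx : 0 ≤ x) (hxy : x ≤ y) (hy : y ≤ n) : σ x ≤ σ y :=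
  h.mono ⟨hx, hxy.trans hy⟩ ⟨hx.trans hxy, hy⟩ hxy

lemma nonneg (h : IsProfile n d σ) {x : ℝ} (hx : 0 ≤ x) (hn : x ≤ n) : 0 ≤ σ x :=
  h.zero ▸ h.le le_rfl hx hn

lemma n_nonneg (h : IsProfile n d σ) : 0 ≤ n := h.d_nonneg.trans h.d_le

end IsProfile

/-- The measure `dσ ⊗ dτ` of the region below the staircase with heights `y₁ ≥ y₂ ≥ y₃` on
`[0, x₁]`, `[x₁, x₂]`, `[x₂, x₃]`. -/
def staircase (σ τ : ℝ → ℝ) (x₁ x₂ x₃ y₁ y₂ y₃ : ℝ) : ℝ :=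
  σ x₁ * τ y₁ + (σ x₂ - σ x₁) * τ y₂ + (σ x₃ - σ x₂) * τ y₃

lemma staircase_transpose (σ τ : ℝ → ℝ) (x₁ x₂ x₃ y₁ y₂ y₃ : ℝ) :
    staircase τ σ y₃ y₂ y₁ x₃ x₂ x₁ = staircase σ τ x₁ x₂ x₃ y₁ y₂ y₃ := by
  unfold staircase; ring

/-- A rectangle with sides beyond the thresholds has area at least `a` and value at most `v`. -/
def RectBelow (n d : ℝ) (σ : ℝ → ℝ) (n' d' : ℝ) (τ : ℝ → ℝ) (a v : ℝ) : Prop :=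
  ∃ x ∈ Icc d n, ∃ y ∈ Icc d' n', a ≤ x * y ∧ σ x * τ y ≤ v

/-- An L-shape has area at least `a` and value at most `v`. -/
def LShapeBelow (n : ℝ) (σ : ℝ → ℝ) (n' : ℝ) (τ : ℝ → ℝ) (a v : ℝ) : Prop :=
  ∃ x ∈ Icc 0 n, ∃ y ∈ Icc 0 n', a ≤ x * n' + y * n - x * y ∧
    σ x * τ n' + τ y * σ n - σ x * τ y ≤ v

/-! ### Reduction of staircases to rectangles and L-shapes. -/

section Reduction

variable {n d n' d' : ℝ} {σ τ : ℝ → ℝ}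

lemma RectBelow.swap {a v : ℝ} (h : RectBelow n d σ n' d' τ a v) : RectBelow n' d' τ n d σ a v := by
  obtain ⟨x, hx, y, hy, h1, h2⟩ := h
  exact ⟨y, hy, x, hx, by linarith [mul_comm x y], by linarith [mul_comm (σ x) (τ y)]⟩

lemma LShapeBelow.swap {a v : ℝ} (h : LShapeBelow n σ n' τ a v) : LShapeBelow n' τ n σ a v := by
  obtain ⟨x, hx, y, hy, h1, h2⟩ := h
  exact ⟨y, hy, x, hx, by linarith [mul_comm x y], by linarith [mul_comm (σ x) (τ y)]⟩

lemma RectBelow.mono {a v a' v' : ℝ} (h : RectBelow n d σ n' d' τ a v) (ha : a' ≤ a)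
    (hv : v ≤ v') : RectBelow n d σ n' d' τ a' v' := by
  obtain ⟨x, hx, y, hy, h1, h2⟩ := h
  exact ⟨x, hx, y, hy, ha.trans h1, h2.trans hv⟩

lemma LShapeBelow.mono {a v a' v' : ℝ} (h : LShapeBelow n σ n' τ a v) (ha : a' ≤ a)
    (hv : v ≤ v') : LShapeBelow n σ n' τ a' v' := by
  obtain ⟨x, hx, y, hy, h1, h2⟩ := h
  exact ⟨x, hx, y, hy, ha.trans h1, h2.trans hv⟩

/-- A two-step staircase of full height lies above a rectangle or an L-shape. -/
lemma rect_or_lShape_of_full_height (hσ : IsProfile n d σ) (hτ : IsProfile n' d' τ)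
    {x₁ x₂ y : ℝ} (hx₁ : d ≤ x₁) (hx : x₁ ≤ x₂) (hx₂ : x₂ ≤ n) (hy : d' ≤ y) (hy' : y ≤ n') :
    RectBelow n d σ n' d' τ (x₁ * n' + (x₂ - x₁) * y) (σ x₁ * τ n' + (σ x₂ - σ x₁) * τ y) ∨
      LShapeBelow n σ n' τ (x₁ * n' + (x₂ - x₁) * y) (σ x₁ * τ n' + (σ x₂ - σ x₁) * τ y) := by
  have hy0 := hτ.d_nonneg.trans hy
  have hd := hσ.d_nonneg
  -- The lower limit is `0` and not `d`: if `q` reaches `0` the tall step disappears, and the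
  -- remaining width `p ≥ x₂` is still beyond `d`.
  obtain ⟨p, q, h1, h2, h3, h4, h5, h6⟩ := exists_exchange hσ.concave hσ.mono (lo := 0) (hi := n)
    (p := x₂) (q := x₁) (l := y) (m := n' - y) (α := τ y) (β := τ n' - τ y) le_rfl (by linarith) hx
    hx₂ le_rfl hy0 (by linarith) (hτ.nonneg hy0 hy') (by linarith [hτ.le hy0 hy' le_rfl])
  rcases h6 with ⟨rfl, h6⟩ | ⟨rfl, h6⟩ | rfl
  · exact Or.inl ⟨p, ⟨by linarith, h3⟩, n', ⟨hτ.d_le, le_rfl⟩, by linarith, by linarith⟩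
  · rw [hσ.zero] at h5
    exact Or.inl ⟨p, ⟨by linarith, h3⟩, y, ⟨hy, hy'⟩, by linarith, by linarith⟩
  · exact Or.inr ⟨q, ⟨h1, h2⟩, y, ⟨hy0, hy'⟩, by linarith, by linarith⟩

/-- A two-step staircase lies above a rectangle or an L-shape. -/
lemma rect_or_lShape_of_two_steps (hσ : IsProfile n d σ) (hτ : IsProfile n' d' τ)
    {x₁ x₂ y₁ y₂ : ℝ} (hx₁ : d ≤ x₁) (hx : x₁ ≤ x₂) (hx₂ : x₂ ≤ n) (hy₂ : d' ≤ y₂) (hy : y₂ ≤ y₁)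
    (hy₁ : y₁ ≤ n') :
    RectBelow n d σ n' d' τ (x₁ * y₁ + (x₂ - x₁) * y₂) (σ x₁ * τ y₁ + (σ x₂ - σ x₁) * τ y₂) ∨
      LShapeBelow n σ n' τ (x₁ * y₁ + (x₂ - x₁) * y₂) (σ x₁ * τ y₁ + (σ x₂ - σ x₁) * τ y₂) := by
  have hx0 := hσ.d_nonneg.trans hx₁
  have hy0 := hτ.d_nonneg.trans hy₂
  rcases hx0.eq_or_lt with h0 | h0
  · subst h0
    refine Or.inl ⟨x₂, ⟨hx₁.trans hx, hx₂⟩, y₂, ⟨hy₂, hy.trans hy₁⟩, ?_, ?_⟩ <;> simp [hσ.zero]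
  rcases hy0.eq_or_lt with h0' | h0'
  · subst h0'
    refine Or.inl ⟨x₁, ⟨hx₁, hx.trans hx₂⟩, y₁, ⟨hy₂.trans hy, hy₁⟩, ?_, ?_⟩ <;> simp [hτ.zero]
  -- For fixed `x₁` and `y₂` the area is `x₁ * y₁ + y₂ * x₂` up to a constant, and the value
  -- separates likewise, so the outer dimensions `y₁` and `x₂` can be traded. Each end is a
  -- rectangle or has full height or full width.
  obtain ⟨p, ⟨hp, hp'⟩, q, ⟨hq, hq'⟩, h1, h2, h3⟩ := exists_exchange_mixed hτ.concave hσ.concave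
    (p₀ := y₂) (p₁ := n') (q₀ := x₁) (q₁ := n) (p := y₁) (q := x₂) (l := x₁) (m := y₂)
    (α := σ x₁) (β := τ y₂) (Icc_subset_Icc h0'.le le_rfl) (Icc_subset_Icc h0.le le_rfl)
    ⟨hy, hy₁⟩ ⟨hx, hx₂⟩ h0 h0' (hσ.nonneg hx0 (hx.trans hx₂)) (hτ.nonneg hy0 (hy.trans hy₁))
  rcases h3 with rfl | rfl | rfl | rfl
  · exact Or.inl ⟨q, ⟨hx₁.trans hq, hq'⟩, p, ⟨hy₂, hp'⟩, by linarith, by linarith⟩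
  · refine (rect_or_lShape_of_full_height hσ hτ hx₁ hq hq' hy₂ hp).imp
      (fun h => h.mono ?_ ?_) (fun h => h.mono ?_ ?_) <;> linarith
  · exact Or.inl ⟨q, ⟨hx₁, hq'⟩, p, ⟨hy₂.trans hp, hp'⟩, by linarith, by linarith⟩
  · refine (rect_or_lShape_of_full_height hτ hσ hy₂ hp hp' hx₁ hq).imp
      (fun h => h.swap.mono ?_ ?_) (fun h => h.swap.mono ?_ ?_) <;> linarith

/-- A three-step staircase reaching both full width and full height lies above a rectangle or an
L-shape. -/
lemma rect_or_lShape_of_full (hσ : IsProfile n d σ) (hτ : IsProfile n' d' τ) {x₁ x₂ y₂ y₃ : ℝ}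
    (hx₁ : d ≤ x₁) (hx₁₂ : x₁ ≤ x₂) (hx₂ : x₂ ≤ n) (hy₃ : d' ≤ y₃) (hy₂₃ : y₃ ≤ y₂)
    (hy₂ : y₂ ≤ n') :
    RectBelow n d σ n' d' τ (staircase id id x₁ x₂ n n' y₂ y₃) (staircase σ τ x₁ x₂ n n' y₂ y₃) ∨
      LShapeBelow n σ n' τ (staircase id id x₁ x₂ n n' y₂ y₃)
        (staircase σ τ x₁ x₂ n n' y₂ y₃) := by
  have hy0 := hτ.d_nonneg.trans hy₃
  have hd := hσ.d_nonneg
  simp only [staircase, id]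
  obtain ⟨p, q, h1, h2, h3, h4, h5, h6⟩ := exists_exchange hσ.concave hσ.mono (lo := 0) (hi := n)
    (p := x₂) (q := x₁) (l := y₂ - y₃) (m := n' - y₂) (α := τ y₂ - τ y₃) (β := τ n' - τ y₂) le_rfl
    (by linarith) hx₁₂ hx₂ le_rfl (by linarith) (by linarith) (by linarith [hτ.le hy0 hy₂₃ hy₂])
    (by linarith [hτ.le (hy0.trans hy₂₃) hy₂ le_rfl])
  rcases h6 with ⟨rfl, h6⟩ | ⟨rfl, h6⟩ | rfl
  · refine (rect_or_lShape_of_two_steps hσ hτ (hx₁.trans h6) h3 le_rfl hy₃ (hy₂₃.trans hy₂)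
      le_rfl).imp (fun h => h.mono ?_ ?_) (fun h => h.mono ?_ ?_) <;> linarith
  · rw [hσ.zero] at h5
    refine (rect_or_lShape_of_two_steps hσ hτ ((hx₁.trans hx₁₂).trans h6) h3 le_rfl hy₃ hy₂₃
      hy₂).imp (fun h => h.mono ?_ ?_) (fun h => h.mono ?_ ?_) <;> linarith
  · exact Or.inr ⟨q, ⟨h1, h2⟩, y₂, ⟨hy0.trans hy₂₃, hy₂⟩, by linarith, by linarith⟩

/-- A three-step staircase of full height lies above a rectangle or an L-shape. -/
lemma rect_or_lShape_of_three_steps_full_height (hσ : IsProfile n d σ) (hτ : IsProfile n' d' τ)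
    {x₁ x₂ x₃ y₂ y₃ : ℝ} (hx₁ : d ≤ x₁) (hx₁₂ : x₁ ≤ x₂) (hx₂₃ : x₂ ≤ x₃) (hx₃ : x₃ ≤ n)
    (hy₃ : d' ≤ y₃) (hy₂₃ : y₃ ≤ y₂) (hy₂ : y₂ ≤ n') :
    RectBelow n d σ n' d' τ (staircase id id x₁ x₂ x₃ n' y₂ y₃)
        (staircase σ τ x₁ x₂ x₃ n' y₂ y₃) ∨
      LShapeBelow n σ n' τ (staircase id id x₁ x₂ x₃ n' y₂ y₃)
        (staircase σ τ x₁ x₂ x₃ n' y₂ y₃) := by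
  have hy0 := hτ.d_nonneg.trans hy₃
  have hx0 := hσ.d_nonneg.trans hx₁
  obtain ⟨p, q, h1, h2, h3, h4, h5, h6⟩ := exists_exchange hσ.concave hσ.mono (lo := x₁) (hi := n)
    (p := x₃) (q := x₂) (l := y₃) (m := y₂ - y₃) (α := τ y₃) (β := τ y₂ - τ y₃) hx0 hx₁₂ hx₂₃ hx₃
    le_rfl hy0 (by linarith) (hτ.nonneg hy0 (hy₂₃.trans hy₂)) (by linarith [hτ.le hy0 hy₂₃ hy₂])
  rcases h6 with ⟨rfl, h6⟩ | ⟨rfl, h6⟩ | rfl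
  · refine (rect_or_lShape_of_two_steps hσ hτ hx₁ h1 h3 (hy₃.trans hy₂₃) hy₂
      le_rfl).imp (fun h => h.mono ?_ ?_) (fun h => h.mono ?_ ?_) <;>
        simp only [staircase, id] <;> linarith
  · refine (rect_or_lShape_of_two_steps hσ hτ hx₁ h2 h3 hy₃ (hy₂₃.trans hy₂)
      le_rfl).imp (fun h => h.mono ?_ ?_) (fun h => h.mono ?_ ?_) <;>
        simp only [staircase, id] <;> linarith
  · refine (rect_or_lShape_of_full hσ hτ hx₁ h1 h2 hy₃ hy₂₃ hy₂).imp
      (fun h => h.mono ?_ ?_) (fun h => h.mono ?_ ?_) <;> simp only [staircase, id] <;> linarith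

/-- A three-step staircase lies above a rectangle or an L-shape. -/
lemma rect_or_lShape_of_three_steps (hσ : IsProfile n d σ) (hτ : IsProfile n' d' τ)
    {x₁ x₂ x₃ y₁ y₂ y₃ : ℝ} (hx₁ : d ≤ x₁) (hx₁₂ : x₁ ≤ x₂) (hx₂₃ : x₂ ≤ x₃) (hx₃ : x₃ ≤ n)
    (hy₃ : d' ≤ y₃) (hy₂₃ : y₃ ≤ y₂) (hy₁₂ : y₂ ≤ y₁) (hy₁ : y₁ ≤ n') :
    RectBelow n d σ n' d' τ (staircase id id x₁ x₂ x₃ y₁ y₂ y₃)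
        (staircase σ τ x₁ x₂ x₃ y₁ y₂ y₃) ∨
      LShapeBelow n σ n' τ (staircase id id x₁ x₂ x₃ y₁ y₂ y₃)
        (staircase σ τ x₁ x₂ x₃ y₁ y₂ y₃) := by
  have hy0 := hτ.d_nonneg.trans hy₃
  have hx0 := hσ.d_nonneg.trans hx₁
  obtain ⟨p, q, h1, h2, h3, h4, h5, h6⟩ := exists_exchange hτ.concave hτ.mono (lo := y₃) (hi := n')
    (p := y₁) (q := y₂) (l := x₁) (m := x₂ - x₁) (α := σ x₁) (β := σ x₂ - σ x₁) hy0 hy₂₃ hy₁₂ hy₁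
    le_rfl hx0 (by linarith) (hσ.nonneg hx0 (by linarith))
    (by linarith [hσ.le hx0 hx₁₂ (hx₂₃.trans hx₃)])
  rcases h6 with ⟨rfl, h6⟩ | ⟨rfl, h6⟩ | rfl
  · refine (rect_or_lShape_of_two_steps hσ hτ (hx₁.trans hx₁₂) hx₂₃ hx₃ hy₃ h1
      h3).imp (fun h => h.mono ?_ ?_) (fun h => h.mono ?_ ?_) <;>
        simp only [staircase, id] <;> linarith
  · refine (rect_or_lShape_of_two_steps hσ hτ hx₁ (hx₁₂.trans hx₂₃) hx₃ hy₃ h2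
      h3).imp (fun h => h.mono ?_ ?_) (fun h => h.mono ?_ ?_) <;>
        simp only [staircase, id] <;> linarith
  · refine (rect_or_lShape_of_three_steps_full_height hσ hτ hx₁ hx₁₂ hx₂₃ hx₃ hy₃ h1 h2).imp
      (fun h => h.mono ?_ ?_) (fun h => h.mono ?_ ?_) <;> simp only [staircase, id] <;> linarith

/-- A two-step staircase lies above a rectangle or has value at least `τ n'`. -/
lemma rect_or_le_of_two_steps (hσ : IsProfile n d σ) (hτ : IsProfile n' d' τ)
    {x₁ x₂ y₁ y₂ : ℝ} (hx₁ : d ≤ x₁) (hx : x₁ ≤ x₂) (hx₂ : x₂ ≤ n) (hy₂ : d' ≤ y₂) (hy : y₂ ≤ y₁)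
    (hy₁ : y₁ ≤ n') :
    RectBelow n d σ n' d' τ (x₁ * y₁ + (x₂ - x₁) * y₂) (σ x₁ * τ y₁ + (σ x₂ - σ x₁) * τ y₂) ∨
      τ n' ≤ σ x₁ * τ y₁ + (σ x₂ - σ x₁) * τ y₂ := by
  have hx0 := hσ.d_nonneg.trans hx₁
  have hy0 := hτ.d_nonneg.trans hy₂
  rcases hσ.one_le x₁ hx₁ (hx.trans hx₂) with h1 | rfl
  swap
  · obtain rfl : x₂ = x₁ := le_antisymm hx₂ hx
    exact Or.inl ⟨x₂, ⟨hx₁, le_rfl⟩, y₁, ⟨hy₂.trans hy, hy₁⟩, by simp, by simp⟩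
  have hx12 := hσ.le hx0 hx hx₂
  obtain ⟨p, q, h1, h2, h3, h4, h5, h6⟩ := exists_exchange hτ.concave hτ.mono (lo := 0) (hi := n')
    (p := y₁) (q := y₂) (l := x₁) (m := x₂ - x₁) (α := σ x₁) (β := σ x₂ - σ x₁) le_rfl hy0 hy hy₁
    le_rfl hx0 (by linarith) (hσ.nonneg hx0 (by linarith)) (by linarith)
  rcases h6 with ⟨rfl, h6⟩ | ⟨rfl, h6⟩ | rfl
  · exact Or.inl ⟨x₂, ⟨hx₁.trans hx, hx₂⟩, p, ⟨hy₂.trans h6, h3⟩, by linarith, by linarith⟩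
  · rw [hτ.zero] at h5
    exact Or.inl ⟨x₁, ⟨hx₁, hx.trans hx₂⟩, p, ⟨by linarith, h3⟩, by linarith, by linarith⟩
  -- The first step now has full height, and `1 ≤ σ x₁` makes it alone worth `τ n'`.
  · right
    have e1 := hτ.nonneg h1 h2
    have e2 := hτ.nonneg (h1.trans h2) le_rfl
    nlinarith

/-- A three-step staircase lies above a rectangle or has value at least `τ n'`. -/
lemma rect_or_le_of_three_steps (hσ : IsProfile n d σ) (hτ : IsProfile n' d' τ)
    {x₁ x₂ x₃ y₁ y₂ y₃ : ℝ} (hx₁ : d ≤ x₁) (hx₁₂ : x₁ ≤ x₂) (hx₂₃ : x₂ ≤ x₃) (hx₃ : x₃ ≤ n)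
    (hy₃ : d' ≤ y₃) (hy₂₃ : y₃ ≤ y₂) (hy₁₂ : y₂ ≤ y₁) (hy₁ : y₁ ≤ n') :
    RectBelow n d σ n' d' τ (staircase id id x₁ x₂ x₃ y₁ y₂ y₃)
        (staircase σ τ x₁ x₂ x₃ y₁ y₂ y₃) ∨ τ n' ≤ staircase σ τ x₁ x₂ x₃ y₁ y₂ y₃ := by
  have hy0 := hτ.d_nonneg.trans hy₃
  have hx0 := hσ.d_nonneg.trans hx₁
  have hx12 := hσ.le hx0 hx₁₂ (hx₂₃.trans hx₃)
  have hx23 := hσ.le (hx0.trans hx₁₂) hx₂₃ hx₃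
  rcases hσ.one_le x₁ hx₁ (by linarith) with h1 | rfl
  swap
  · obtain rfl : x₂ = x₁ := le_antisymm (by linarith) hx₁₂
    obtain rfl : x₃ = x₂ := le_antisymm hx₃ hx₂₃
    exact Or.inl ⟨x₃, ⟨hx₁, le_rfl⟩, y₁, ⟨by linarith, hy₁⟩, by simp [staircase],
      by simp [staircase]⟩
  obtain ⟨p, q, h1, h2, h3, h4, h5, h6⟩ := exists_exchange hτ.concave hτ.mono (lo := y₃) (hi := n')
    (p := y₁) (q := y₂) (l := x₁) (m := x₂ - x₁) (α := σ x₁) (β := σ x₂ - σ x₁) hy0 hy₂₃ hy₁₂ hy₁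
    le_rfl hx0 (by linarith) (hσ.nonneg hx0 (by linarith)) (by linarith)
  rcases h6 with ⟨rfl, h6⟩ | ⟨rfl, h6⟩ | rfl
  · refine (rect_or_le_of_two_steps hσ hτ (hx₁.trans hx₁₂) hx₂₃ hx₃ hy₃ h1
      h3).imp (fun h => h.mono ?_ ?_) (fun h => h.trans ?_) <;>
        simp only [staircase, id] <;> linarith
  · refine (rect_or_le_of_two_steps hσ hτ hx₁ (hx₁₂.trans hx₂₃) hx₃ hy₃ h2
      h3).imp (fun h => h.mono ?_ ?_) (fun h => h.trans ?_) <;>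
        simp only [staircase, id] <;> linarith
  · right
    have e1 := hτ.nonneg (hy0.trans h1) h2
    have e2 := hτ.nonneg hτ.n_nonneg le_rfl
    have e3 := hτ.nonneg hy0 (h1.trans h2)
    have e4 : 0 ≤ (σ x₂ - σ x₁) * τ q := mul_nonneg (by linarith) e1
    have e5 : 0 ≤ (σ x₃ - σ x₂) * τ y₃ := mul_nonneg (by linarith) e3
    have e6 : τ p ≤ σ x₁ * τ p := le_mul_of_one_le_left e2 ‹_›
    simp only [staircase]
    linarith

/-- A three-step staircase lies above a rectangle, or its value is at least that of an L-shape
and at least `max (σ n) (τ n')`. -/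
lemma rect_or_lShape_and_max_le (hσ : IsProfile n d σ) (hτ : IsProfile n' d' τ)
    {x₁ x₂ x₃ y₁ y₂ y₃ : ℝ} (hx₁ : d ≤ x₁) (hx₁₂ : x₁ ≤ x₂) (hx₂₃ : x₂ ≤ x₃) (hx₃ : x₃ ≤ n)
    (hy₃ : d' ≤ y₃) (hy₂₃ : y₃ ≤ y₂) (hy₁₂ : y₂ ≤ y₁) (hy₁ : y₁ ≤ n') :
    RectBelow n d σ n' d' τ (staircase id id x₁ x₂ x₃ y₁ y₂ y₃)
        (staircase σ τ x₁ x₂ x₃ y₁ y₂ y₃) ∨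
      LShapeBelow n σ n' τ (staircase id id x₁ x₂ x₃ y₁ y₂ y₃)
        (staircase σ τ x₁ x₂ x₃ y₁ y₂ y₃) ∧
      max (σ n) (τ n') ≤ staircase σ τ x₁ x₂ x₃ y₁ y₂ y₃ := by
  refine or_iff_not_imp_left.2 fun hR => ⟨?_, max_le ?_ ?_⟩
  · exact (rect_or_lShape_of_three_steps hσ hτ hx₁ hx₁₂ hx₂₃ hx₃ hy₃ hy₂₃ hy₁₂ hy₁).resolve_left hR
  · have := rect_or_le_of_three_steps hτ hσ hy₃ hy₂₃ hy₁₂ hy₁ hx₁ hx₁₂ hx₂₃ hx₃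
    rw [staircase_transpose σ τ, staircase_transpose id id] at this
    exact this.resolve_left fun h => hR h.swap
  · exact (rect_or_le_of_three_steps hσ hτ hx₁ hx₁₂ hx₂₃ hx₃ hy₃ hy₂₃ hy₁₂ hy₁).resolve_left hR

/-- A staircase with many steps can be replaced by one with three steps, of the same area and of
at most the same value. -/
lemma exists_three_steps (hσ : IsProfile n d σ) (hτ : IsProfile n' d' τ) (x y : ℕ → ℝ)
    (hx0 : x 0 = 0) (hx1 : d ≤ x 1) (T : ℕ) (hx : ∀ t ≤ T, x t ≤ x (t + 1)) (hxn : x (T + 1) ≤ n)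
    (hy : ∀ t < T, y (t + 1) ≤ y t) (hy1 : y 0 ≤ n') (z : ℝ) (hz0 : 0 ≤ z) (hz : z ≤ y T) :
    ∃ x₁ x₂ y₁ y₂, d ≤ x₁ ∧ x₁ ≤ x₂ ∧ x₂ ≤ x (T + 1) ∧ z ≤ y₂ ∧ y₂ ≤ y₁ ∧ y₁ ≤ n' ∧
      staircase id id x₁ x₂ (x (T + 1)) y₁ y₂ z
        = ∑ t ∈ Finset.range (T + 1), (x (t + 1) - x t) * y t ∧
      staircase σ τ x₁ x₂ (x (T + 1)) y₁ y₂ z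
        ≤ ∑ t ∈ Finset.range (T + 1), (σ (x (t + 1)) - σ (x t)) * τ (y t) := by
  -- The last height `z` is left free. With `z = y (T + 1)` the induction hypothesis lets the next
  -- step merely widen the third one; an exchange between `y₂` and `y (T + 1)` then frees a step,
  -- which is kept with width zero or has height `z`.
  induction T generalizing z with
  | zero =>
    refine ⟨x 1, x 1, y 0, y 0, hx1, le_rfl, le_rfl, hz, le_rfl, hy1, ?_, ?_⟩ <;>
      simp [staircase, hx0, hσ.zero]
  | succ T ih =>
    have hxT : x (T + 1) ≤ x (T + 1 + 1) := hx (T + 1) le_rfl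
    obtain ⟨x₁, x₂, y₁, y₂, h1, h2, h3, h4, h5, h6, h7, h8⟩ := ih (fun t ht => hx t (by omega))
      (hxT.trans hxn) (fun t ht => hy t (by omega)) (y (T + 1)) (hz0.trans hz) (hy T (by omega))
    have hx₂ : 0 ≤ x₂ := hσ.d_nonneg.trans (h1.trans h2)
    obtain ⟨p, q, e1, e2, e3, e4, e5, e6⟩ := exists_exchange hτ.concave hτ.mono (lo := z)
      (hi := y₁) (p := y₂) (q := y (T + 1)) (l := x₂ - x₁) (m := x (T + 1 + 1) - x₂)
      (α := σ x₂ - σ x₁) (β := σ (x (T + 1 + 1)) - σ x₂) hz0 hz h4 h5 h6 (by linarith)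
      (by linarith)
      (sub_nonneg.2 (hσ.le (hσ.d_nonneg.trans h1) h2 ((h3.trans hxT).trans hxn)))
      (sub_nonneg.2 (hσ.le hx₂ (h3.trans hxT) hxn))
    rw [Finset.sum_range_succ, Finset.sum_range_succ _ (T + 1), ← h7]
    have h8' := add_le_add_left h8 ((σ (x (T + 1 + 1)) - σ (x (T + 1))) * τ (y (T + 1)))
    simp only [staircase, id] at h8' ⊢
    rcases e6 with ⟨rfl, e6⟩ | ⟨rfl, e6⟩ | rfl
    · exact ⟨x₁, x (T + 1 + 1), y₁, p, h1, by linarith, le_rfl, e1, e3, h6, by linarith,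
        by linarith⟩
    · exact ⟨x₁, x₂, y₁, p, h1, h2, h3.trans hxT, e2, e3, h6, by linarith, by linarith⟩
    · exact ⟨x₂, x (T + 1 + 1), p, q, h1.trans h2, by linarith, le_rfl, e1, e2, h6, by linarith,
        by linarith⟩

end Reduction

/-! ### The threshold at which a bound reaches 1. -/

section Pseudoinverse

variable {n : ℕ} {σ : ℝ → ℝ}

lemma pseudoinverse_mem (hcont : ContinuousOn σ (Icc (0 : ℝ) n)) (h0 : σ 0 = 0) :
    pseudoinverse n σ 1 ∈ {k : ℝ | k ∈ Icc (0 : ℝ) n ∧ σ k ≤ 1} := by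
  refine IsClosed.csSup_mem ?_ ⟨0, ⟨le_rfl, Nat.cast_nonneg n⟩, by simp [h0]⟩
    ⟨n, fun x hx => hx.1.2⟩
  exact hcont.preimage_isClosed_of_isClosed isClosed_Icc isClosed_Iic

lemma le_pseudoinverse {x : ℝ} (hx : x ∈ Icc (0 : ℝ) n) (h : σ x ≤ 1) :
    x ≤ pseudoinverse n σ 1 :=
  le_csSup ⟨n, fun _ hy => hy.1.2⟩ ⟨hx, h⟩

/-- If the value were below 1 at some point of `[d, n)`, the intermediate value theorem would give a
later point with value at most 1, contradicting that `d` is the supremum of such points. -/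
lemma isProfile_pseudoinverse (hcont : ContinuousOn σ (Icc (0 : ℝ) n))
    (hmono : MonotoneOn σ (Icc (0 : ℝ) n)) (hc : ConcaveOn ℝ (Icc (0 : ℝ) n) σ) (h0 : σ 0 = 0) :
    IsProfile n (pseudoinverse n σ 1) σ := by
  obtain ⟨⟨hd0, hdn⟩, hd1⟩ := pseudoinverse_mem hcont h0
  refine ⟨hd0, hdn, hc, hmono, h0, fun x hx hxn => ?_⟩
  by_contra! h
  obtain ⟨h1, h2⟩ := h
  have hxn' : x < n := lt_of_le_of_ne hxn h2
  have hx0 : 0 ≤ x := hd0.trans hx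
  obtain ⟨y, hy, hy1⟩ : ∃ y ∈ Ioc x n, σ y ≤ 1 := by
    rcases le_total (σ n) 1 with hn | hn
    · exact ⟨n, ⟨hxn', le_rfl⟩, hn⟩
    · obtain ⟨y, hy, hy'⟩ := intermediate_value_Icc hxn
        (hcont.mono (Icc_subset_Icc hx0 le_rfl)) ⟨h1.le, hn⟩
      refine ⟨y, ⟨lt_of_le_of_ne hy.1 ?_, hy.2⟩, hy'.le⟩
      rintro rfl
      exact h1.ne hy'
  exact absurd (le_pseudoinverse ⟨hx0.trans hy.1.le, hy.2⟩ hy1) (not_le.2 (hx.trans_lt hy.1))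

end Pseudoinverse

/-! ### Existence and continuity of the constrained minima. -/

/-- The minimal value of a continuous function on a compact set under the constraint `k ≤ g x`
depends continuously on `k ≤ N` if small moves allow `g` to increase uniformly towards `N`. -/
lemma continuousOn_constrained_min {X : Type*} [PseudoMetricSpace X] {K : Set X}
    (hK : IsCompact K) {V g : X → ℝ} (hV : ContinuousOn V K) {N : ℝ} {Γ : ℝ → ℝ}
    (hmin : ∀ k ∈ Icc 0 N, ∃ x ∈ K, k ≤ g x ∧ V x = Γ k)
    (hle : ∀ k ∈ Icc 0 N, ∀ x ∈ K, k ≤ g x → Γ k ≤ V x)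
    (hmove : ∀ ε > 0, ∃ δ > 0, ∀ x ∈ K, ∃ x' ∈ K, dist x' x ≤ ε ∧ min (g x + δ) N ≤ g x') :
    ContinuousOn Γ (Icc 0 N) := by
  have hmono : ∀ k ∈ Icc 0 N, ∀ l ∈ Icc 0 N, k ≤ l → Γ k ≤ Γ l := by
    intro k hk l hl hkl
    obtain ⟨x, hx, h1, h2⟩ := hmin l hl
    exact h2 ▸ hle k hk x hx (hkl.trans h1)
  have hunif := Metric.uniformContinuousOn_iff.1 (hK.uniformContinuousOn_of_continuous hV)
  refine UniformContinuousOn.continuousOn (Metric.uniformContinuousOn_iff.2 fun ε hε => ?_)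
  obtain ⟨η, hη, hη'⟩ := hunif ε hε
  obtain ⟨δ, hδ, hδ'⟩ := hmove (η / 2) (by positivity)
  -- A minimiser for `k` is moved slightly to become admissible for `l`; uniform continuity of `V`
  -- bounds the cost.
  have key : ∀ k ∈ Icc 0 N, ∀ l ∈ Icc 0 N, k ≤ l → l < k + δ → Γ l < Γ k + ε := by
    intro k hk l hl hkl hlk
    obtain ⟨x, hx, h1, h2⟩ := hmin k hk
    obtain ⟨x', hx', h3, h4⟩ := hδ' x hx
    have h5 := hle l hl x' hx' ((le_min (by linarith) hl.2).trans h4)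
    have h6 := (abs_lt.1 (Real.dist_eq _ _ ▸ hη' x' hx' x hx (by linarith))).2
    linarith
  refine ⟨δ, hδ, fun k hk l hl hkl => ?_⟩
  rw [Real.dist_eq, abs_lt] at hkl ⊢
  rcases le_total k l with h | h
  · have := key k hk l hl h (by linarith)
    have := hmono k hk l hl h
    constructor <;> linarith
  · have := key l hl k hk h (by linarith)
    have := hmono l hl k hk h
    constructor <;> linarith

lemma dist_min_add_le {x ε n : ℝ} (hε : 0 ≤ ε) (hx : x ≤ n) : dist (min (x + ε) n) x ≤ ε := by
  rw [Real.dist_eq, abs_of_nonneg (sub_nonneg.2 (le_min (by linarith) hx))]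
  linarith [min_le_left (x + ε) n]

section Bounds

variable {nA nB : ℕ} {σA σB : ℝ → ℝ}

lemma isLeast_rectBound (hA : ContinuousOn σA (Icc (0 : ℝ) nA))
    (hB : ContinuousOn σB (Icc (0 : ℝ) nB)) (pA : IsProfile nA (pseudoinverse nA σA 1) σA)
    (pB : IsProfile nB (pseudoinverse nB σB 1) σB) {k : ℝ} (hk : k ∈ Icc (0 : ℝ) (nA * nB)) :
    IsLeast (rectValues nA nB σA σB k) (rectBound nA nB σA σB k) := by
  have hK : IsCompact ((Icc (pseudoinverse nA σA 1) (nA : ℝ) ×ˢ Icc (pseudoinverse nB σB 1) (nB : ℝ))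
      ∩ {p : ℝ × ℝ | k ≤ p.1 * p.2}) :=
    (isCompact_Icc.prod isCompact_Icc).inter_right
      (isClosed_le continuous_const (continuous_fst.mul continuous_snd))
  have hV : ContinuousOn (fun p : ℝ × ℝ => σA p.1 * σB p.2)
      ((Icc (pseudoinverse nA σA 1) (nA : ℝ) ×ˢ Icc (pseudoinverse nB σB 1) (nB : ℝ))
        ∩ {p : ℝ × ℝ | k ≤ p.1 * p.2}) :=
    (hA.comp continuousOn_fst fun p hp => ⟨pA.d_nonneg.trans hp.1.1.1, hp.1.1.2⟩).mul
      (hB.comp continuousOn_snd fun p hp => ⟨pB.d_nonneg.trans hp.1.2.1, hp.1.2.2⟩)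
  have hne : ((nA : ℝ), (nB : ℝ)) ∈ ((Icc (pseudoinverse nA σA 1) (nA : ℝ) ×ˢ
      Icc (pseudoinverse nB σB 1) (nB : ℝ)) ∩ {p : ℝ × ℝ | k ≤ p.1 * p.2}) :=
    ⟨⟨⟨pA.d_le, le_rfl⟩, ⟨pB.d_le, le_rfl⟩⟩, hk.2⟩
  have hS : rectValues nA nB σA σB k = (fun p : ℝ × ℝ => σA p.1 * σB p.2) ''
      ((Icc (pseudoinverse nA σA 1) (nA : ℝ) ×ˢ Icc (pseudoinverse nB σB 1) (nB : ℝ))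
        ∩ {p : ℝ × ℝ | k ≤ p.1 * p.2}) := by
    ext v
    constructor
    · rintro ⟨x, hx, y, hy, h1, rfl⟩
      exact ⟨(x, y), ⟨⟨hx, hy⟩, h1⟩, rfl⟩
    · rintro ⟨⟨x, y⟩, ⟨⟨hx, hy⟩, h1⟩, rfl⟩
      exact ⟨x, hx, y, hy, h1, rfl⟩
  rw [rectBound, hS]
  exact (hK.image_of_continuousOn hV).isLeast_sInf (Set.Nonempty.image _ ⟨_, hne⟩)

lemma rectBound_le_of_rectBelow (hA : ContinuousOn σA (Icc (0 : ℝ) nA))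
    (hB : ContinuousOn σB (Icc (0 : ℝ) nB)) (pA : IsProfile nA (pseudoinverse nA σA 1) σA)
    (pB : IsProfile nB (pseudoinverse nB σB 1) σB) {k v : ℝ} (hk : k ∈ Icc (0 : ℝ) (nA * nB))
    (h : RectBelow nA (pseudoinverse nA σA 1) σA nB (pseudoinverse nB σB 1) σB k v) :
    rectBound nA nB σA σB k ≤ v := by
  obtain ⟨x, hx, y, hy, h1, h2⟩ := h
  exact ((isLeast_rectBound hA hB pA pB hk).2 ⟨x, hx, y, hy, h1, rfl⟩).trans h2

lemma continuousOn_rectBound (hA : ContinuousOn σA (Icc (0 : ℝ) nA))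
    (hB : ContinuousOn σB (Icc (0 : ℝ) nB)) (pA : IsProfile nA (pseudoinverse nA σA 1) σA)
    (pB : IsProfile nB (pseudoinverse nB σB 1) σB) :
    ContinuousOn (rectBound nA nB σA σB) (Icc (0 : ℝ) (nA * nB)) := by
  refine continuousOn_constrained_min (K := Icc (pseudoinverse nA σA 1) (nA : ℝ) ×ˢ
    Icc (pseudoinverse nB σB 1) (nB : ℝ)) (isCompact_Icc.prod isCompact_Icc)
    (V := fun p : ℝ × ℝ => σA p.1 * σB p.2) (g := fun p => p.1 * p.2) ?_ ?_ ?_ ?_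
  · exact (hA.comp continuousOn_fst fun p hp => ⟨pA.d_nonneg.trans hp.1.1, hp.1.2⟩).mul
      (hB.comp continuousOn_snd fun p hp => ⟨pB.d_nonneg.trans hp.2.1, hp.2.2⟩)
  · intro k hk
    obtain ⟨x, hx, y, hy, h1, h2⟩ := (isLeast_rectBound hA hB pA pB hk).1
    exact ⟨(x, y), ⟨hx, hy⟩, h1, h2.symm⟩
  · rintro k hk ⟨x, y⟩ ⟨hx, hy⟩ h1
    exact (isLeast_rectBound hA hB pA pB hk).2 ⟨x, hx, y, hy, h1, rfl⟩
  · intro ε hε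
    rcases (mul_nonneg pA.n_nonneg pB.n_nonneg).eq_or_lt with h0 | h0
    · refine ⟨1, one_pos, fun p hp => ⟨p, hp, by simpa using hε.le, (min_le_right _ _).trans ?_⟩⟩
      rw [← h0]
      exact mul_nonneg (pA.d_nonneg.trans hp.1.1) (pB.d_nonneg.trans hp.2.1)
    have hA0 : (0 : ℝ) < nA := lt_of_le_of_ne pA.n_nonneg (by rintro h; simp [← h] at h0)
    have hB0 : (0 : ℝ) < nB := lt_of_le_of_ne pB.n_nonneg (by rintro h; simp [← h] at h0)
    -- Both sides grow by `ε`, capped at `nA` and `nB`. The three terms are lower bounds for the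
    -- gain in area when neither side or exactly one side is capped; with both capped the area is
    -- already `nA * nB`.
    refine ⟨min (ε * ε) (min (nA * ε) (nB * ε)), by positivity, ?_⟩
    rintro ⟨x, y⟩ ⟨⟨hx, hx'⟩, ⟨hy, hy'⟩⟩
    dsimp only at hx hx' hy hy'
    have hx0 := pA.d_nonneg.trans hx
    have hy0 := pB.d_nonneg.trans hy
    refine ⟨(min (x + ε) nA, min (y + ε) nB), ⟨⟨le_min (by linarith) pA.d_le, min_le_right _ _⟩,
      ⟨le_min (by linarith) pB.d_le, min_le_right _ _⟩⟩, ?_, ?_⟩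
    · rw [Prod.dist_eq]
      exact max_le (dist_min_add_le hε.le hx') (dist_min_add_le hε.le hy')
    · have e1 : min (ε * ε) (min (nA * ε) (nB * ε)) ≤ ε * ε := min_le_left _ _
      have e2 : min (ε * ε) (min (nA * ε) (nB * ε)) ≤ nA * ε :=
        (min_le_right _ _).trans (min_le_left _ _)
      have e3 : min (ε * ε) (min (nA * ε) (nB * ε)) ≤ nB * ε :=
        (min_le_right _ _).trans (min_le_right _ _)
      dsimp only
      rcases min_cases (x + ε) (nA : ℝ) with ⟨h1, -⟩ | ⟨h1, -⟩ <;>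
      rcases min_cases (y + ε) (nB : ℝ) with ⟨h2, -⟩ | ⟨h2, -⟩ <;> rw [h1, h2]
      · refine (min_le_left _ _).trans ?_
        nlinarith
      · refine (min_le_left _ _).trans ?_
        nlinarith
      · refine (min_le_left _ _).trans ?_
        nlinarith
      · exact min_le_right _ _

lemma isLeast_lShapeBound (hA : ContinuousOn σA (Icc (0 : ℝ) nA))
    (hB : ContinuousOn σB (Icc (0 : ℝ) nB)) {k : ℝ} (hk : k ∈ Icc (0 : ℝ) (nA * nB)) :
    IsLeast (lShapeValues nA nB σA σB k) (lShapeBound nA nB σA σB k) := by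
  set K := (Icc (0 : ℝ) nA ×ˢ Icc (0 : ℝ) nB) ∩
    {p : ℝ × ℝ | p.1 * nB + p.2 * nA - p.1 * p.2 = k} with hKdef
  have hK : IsCompact K :=
    (isCompact_Icc.prod isCompact_Icc).inter_right
      (isClosed_eq (by fun_prop) continuous_const)
  have h1 : ContinuousOn (fun p : ℝ × ℝ => σA p.1) K := hA.comp continuousOn_fst fun p hp => hp.1.1
  have h2 : ContinuousOn (fun p : ℝ × ℝ => σB p.2) K := hB.comp continuousOn_snd fun p hp => hp.1.2
  have hV : ContinuousOn (fun p : ℝ × ℝ => σA p.1 * σB nB + σB p.2 * σA nA - σA p.1 * σB p.2) K :=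
    ((h1.mul continuousOn_const).add (h2.mul continuousOn_const)).sub (h1.mul h2)
  have hne : K.Nonempty := by
    rcases (Nat.cast_nonneg (α := ℝ) nB).eq_or_lt with h0 | h0
    · refine ⟨(0, 0), ⟨⟨le_rfl, Nat.cast_nonneg _⟩, ⟨le_rfl, Nat.cast_nonneg _⟩⟩, ?_⟩
      have := hk.2
      rw [← h0, mul_zero] at this
      simp [le_antisymm this hk.1]
    · refine ⟨(k / nB, 0), ⟨⟨div_nonneg hk.1 h0.le, (div_le_iff₀ h0).2 hk.2⟩,
        ⟨le_rfl, Nat.cast_nonneg _⟩⟩, ?_⟩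
      simp [div_mul_cancel₀ _ h0.ne']
  have hS : lShapeValues nA nB σA σB k =
      (fun p : ℝ × ℝ => σA p.1 * σB nB + σB p.2 * σA nA - σA p.1 * σB p.2) '' K := by
    ext v
    constructor
    · rintro ⟨x, hx, y, hy, h1, rfl⟩
      exact ⟨(x, y), ⟨⟨hx, hy⟩, h1⟩, rfl⟩
    · rintro ⟨⟨x, y⟩, ⟨⟨hx, hy⟩, h1⟩, rfl⟩
      exact ⟨x, hx, y, hy, h1, rfl⟩
  rw [lShapeBound, hS]
  exact (hK.image_of_continuousOn hV).isLeast_sInf (hne.image _)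

/-- `L_C` is defined with an equality constraint, but area at least `k` suffices: scaling `(x, y)`
towards the origin reaches area exactly `k`, and the value is increasing in both coordinates.
Monotonicity of `L_C` rests on this. -/
lemma lShapeBound_le_of_lShapeBelow (hA : ContinuousOn σA (Icc (0 : ℝ) nA))
    (hB : ContinuousOn σB (Icc (0 : ℝ) nB)) (pA : IsProfile nA (pseudoinverse nA σA 1) σA)
    (pB : IsProfile nB (pseudoinverse nB σB 1) σB) {k v : ℝ} (hk : k ∈ Icc (0 : ℝ) (nA * nB))
    (h : LShapeBelow nA σA nB σB k v) :
    lShapeBound nA nB σA σB k ≤ v := by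
  obtain ⟨x, ⟨hx, hx'⟩, y, ⟨hy, hy'⟩, h1, h2⟩ := h
  obtain ⟨t, ⟨ht0, ht1⟩, ht⟩ := intermediate_value_Icc (zero_le_one' ℝ)
    (f := fun t : ℝ => t * x * nB + t * y * nA - t * x * (t * y)) (by fun_prop)
    (show k ∈ Icc _ _ by simpa using ⟨hk.1, h1⟩)
  have ex : t * x ≤ x := mul_le_of_le_one_left hx ht1
  have ey : t * y ≤ y := mul_le_of_le_one_left hy ht1
  have ex0 : 0 ≤ t * x := mul_nonneg ht0 hx
  have ey0 : 0 ≤ t * y := mul_nonneg ht0 hy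
  refine ((isLeast_lShapeBound hA hB hk).2 ⟨t * x, ⟨ex0, ex.trans hx'⟩, t * y,
    ⟨ey0, ey.trans hy'⟩, ht, rfl⟩).trans (le_trans ?_ h2)
  have s1 := pA.le ex0 ex hx'
  have s2 := pB.le ey0 ey hy'
  have s3 := pA.le hx hx' le_rfl
  have s4 := pB.le (ey0) (ey.trans hy') le_rfl
  nlinarith [mul_nonneg (sub_nonneg.2 s1) (sub_nonneg.2 s4),
    mul_nonneg (sub_nonneg.2 s2) (sub_nonneg.2 s3)]

lemma continuousOn_lShapeBound (hA : ContinuousOn σA (Icc (0 : ℝ) nA))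
    (hB : ContinuousOn σB (Icc (0 : ℝ) nB)) (pA : IsProfile nA (pseudoinverse nA σA 1) σA)
    (pB : IsProfile nB (pseudoinverse nB σB 1) σB) :
    ContinuousOn (lShapeBound nA nB σA σB) (Icc (0 : ℝ) (nA * nB)) := by
  have h1 : ContinuousOn (fun p : ℝ × ℝ => σA p.1) (Icc (0 : ℝ) nA ×ˢ Icc (0 : ℝ) nB) :=
    hA.comp continuousOn_fst fun p hp => hp.1
  have h2 : ContinuousOn (fun p : ℝ × ℝ => σB p.2) (Icc (0 : ℝ) nA ×ˢ Icc (0 : ℝ) nB) :=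
    hB.comp continuousOn_snd fun p hp => hp.2
  refine continuousOn_constrained_min (K := Icc (0 : ℝ) nA ×ˢ Icc (0 : ℝ) nB)
    (isCompact_Icc.prod isCompact_Icc)
    (V := fun p : ℝ × ℝ => σA p.1 * σB nB + σB p.2 * σA nA - σA p.1 * σB p.2)
    (g := fun p => p.1 * nB + p.2 * nA - p.1 * p.2)
    (((h1.mul continuousOn_const).add (h2.mul continuousOn_const)).sub (h1.mul h2)) ?_ ?_ ?_
  · intro k hk
    obtain ⟨x, hx, y, hy, h1, h2⟩ := (isLeast_lShapeBound hA hB hk).1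
    exact ⟨(x, y), ⟨hx, hy⟩, h1.ge, h2.symm⟩
  · rintro k hk ⟨x, y⟩ ⟨hx, hy⟩ h1
    exact lShapeBound_le_of_lShapeBelow hA hB pA pB hk ⟨x, hx, y, hy, h1, le_rfl⟩
  · intro ε hε
    -- The area is `nA * nB` minus that of the complementary rectangle. If no cap applies, both
    -- sides of the latter are at least `ε` and shrink by `ε`, a gain of at least `ε * ε`; if a cap
    -- applies, the complement is empty.
    refine ⟨ε * ε, by positivity, ?_⟩
    rintro ⟨x, y⟩ ⟨⟨hx, hx'⟩, ⟨hy, hy'⟩⟩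
    dsimp only at hx hx' hy hy'
    refine ⟨(min (x + ε) nA, min (y + ε) nB), ⟨⟨le_min (by linarith) pA.n_nonneg,
      min_le_right _ _⟩, ⟨le_min (by linarith) pB.n_nonneg, min_le_right _ _⟩⟩, ?_, ?_⟩
    · rw [Prod.dist_eq]
      exact max_le (dist_min_add_le hε.le hx') (dist_min_add_le hε.le hy')
    · dsimp only
      rcases min_cases (x + ε) (nA : ℝ) with ⟨e1, e3⟩ | ⟨e1, -⟩ <;>
      rcases min_cases (y + ε) (nB : ℝ) with ⟨e2, e4⟩ | ⟨e2, -⟩ <;> rw [e1, e2]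
      · refine (min_le_left _ _).trans ?_
        nlinarith
      all_goals exact (min_le_right _ _).trans (by linarith)

end Bounds

/-! ### Summation by parts and spans of columns. -/

open Module

/-- A summation by parts bound: if `f` dominates `g`, then the increments of `f` weighted by a
decreasing nonnegative sequence dominate those of `g`. -/
lemma sum_increments_mul_le {f g c : ℕ → ℝ} (T : ℕ) (h0 : f 0 = g 0)
    (h : ∀ t, 1 ≤ t → t ≤ T + 1 → g t ≤ f t)
    (hc : ∀ t < T, c (t + 1) ≤ c t) (hc0 : 0 ≤ c T) :
    ∑ t ∈ Finset.range (T + 1), (g (t + 1) - g t) * c t ≤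
      ∑ t ∈ Finset.range (T + 1), (f (t + 1) - f t) * c t := by
  -- The boundary term of the summation by parts is kept so that the induction closes.
  have key : ∀ S ≤ T, (f (S + 1) - g (S + 1)) * c S ≤
      ∑ t ∈ Finset.range (S + 1), (f (t + 1) - f t) * c t -
        ∑ t ∈ Finset.range (S + 1), (g (t + 1) - g t) * c t := by
    intro S
    induction S with
    | zero => intro _; simp [h0]; linarith
    | succ S ih =>
      intro hS
      have h1 := ih (by omega)
      have h2 := mul_le_mul_of_nonneg_left (hc S (by omega))
        (sub_nonneg.2 (h (S + 1) (by omega) (by omega)))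
      rw [Finset.sum_range_succ, Finset.sum_range_succ _ (S + 1)]
      linarith
  have := key T le_rfl
  have := mul_nonneg (sub_nonneg.2 (h (T + 1) (by omega) le_rfl)) hc0
  linarith

/-- The span of the columns of `M` with index in `s`. -/
def colSpan {ι κ : Type*} (M : Matrix ι κ ℂ) (s : Set κ) : Submodule ℂ (ι → ℂ) :=
  Submodule.span ℂ (M.col '' s)

section ColSpan

variable {ι κ : Type*} (M : Matrix ι κ ℂ)

lemma finrank_colSpan_range {k : ℕ} (e : Fin k ↪ κ) :
    finrank ℂ (colSpan M (range e)) = (M.submatrix id e).rank := by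
  rw [Matrix.rank_eq_finrank_span_cols, colSpan, ← range_comp]
  rfl

lemma rankExpansion_le_finrank_colSpan [Fintype κ] (s : Finset κ) :
    rankExpansion M s.card ≤ finrank ℂ (colSpan M (s : Set κ)) := by
  have h : range (s.equivFin.symm.toEmbedding.trans (Function.Embedding.subtype _)) = (s : Set κ) := by
    ext x
    simp only [mem_range, Function.Embedding.trans_apply, Function.Embedding.subtype_apply]
    constructor
    · rintro ⟨y, rfl⟩; exact (s.equivFin.symm y).2
    · intro hx; exact ⟨s.equivFin ⟨x, hx⟩, by simp⟩
  conv_rhs => rw [← h]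
  rw [finrank_colSpan_range]
  exact Nat.sInf_le ⟨_, rfl⟩

lemma exists_finset_rankExpansion_eq [Fintype κ] {k : ℕ} (hk : k ≤ Fintype.card κ) :
    ∃ s : Finset κ, s.card = k ∧ rankExpansion M k = finrank ℂ (colSpan M (s : Set κ)) := by
  classical
  have hne : {r : ℕ | ∃ e : Fin k ↪ κ, r = (M.submatrix id e).rank}.Nonempty := by
    obtain ⟨e⟩ := Function.Embedding.nonempty_of_card_le (α := Fin k) (β := κ) (by simpa using hk)
    exact ⟨_, e, rfl⟩
  obtain ⟨e, he⟩ := Nat.sInf_mem hne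
  refine ⟨Finset.univ.map e, by simp, ?_⟩
  rw [Finset.coe_map, Finset.coe_univ, image_univ, finrank_colSpan_range]
  exact he

end ColSpan

/-! ### Rank growth in a Kronecker product. -/

section Kronecker

variable {ι κ ι' κ' : Type*} [Fintype ι] [Fintype ι'] (A : Matrix ι κ ℂ) (B : Matrix ι' κ' ℂ)

/-- Adding the columns `a ⊗ b` with `b` in `J` for one new column `a` of `A` increases the rank by
at least the increment of the rank of the columns of `A` times the rank of the columns in `J`. -/
lemma finrank_colSpan_kronecker_step (s : Set κ) (i : κ) (S : Set (κ × κ')) (J : Set κ')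
    (hS : ∀ p ∈ S, p.1 ∈ s) :
    finrank ℂ (colSpan (A ⊗ₖ B) S) +
        (finrank ℂ (colSpan A (insert i s)) - finrank ℂ (colSpan A s)) * finrank ℂ (colSpan B J) ≤
      finrank ℂ (colSpan (A ⊗ₖ B) (S ∪ {i} ×ˢ J)) := by
  have hle : colSpan (A ⊗ₖ B) S ≤ colSpan (A ⊗ₖ B) (S ∪ {i} ×ˢ J) :=
    Submodule.span_mono (image_mono subset_union_left)
  by_cases hi : A.col i ∈ colSpan A s
  · have : colSpan A (insert i s) = colSpan A s := by
      rw [colSpan, image_insert_eq]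
      exact Submodule.span_insert_eq_span hi
    rw [this, Nat.sub_self, zero_mul, add_zero]
    exact Submodule.finrank_mono hle
  have h1 : finrank ℂ (colSpan A (insert i s)) ≤ finrank ℂ (colSpan A s) + 1 := by
    rw [colSpan, image_insert_eq, Submodule.span_insert]
    refine (Submodule.finrank_add_le_finrank_add_finrank _ _).trans ?_
    have h0 : A.col i ≠ 0 := fun h => hi (by rw [h]; exact zero_mem _)
    rw [finrank_span_singleton h0]
    exact (add_comm _ _).le
  obtain ⟨φ, hφ, hφs⟩ := Submodule.exists_le_ker_of_notMem hi
  -- `Φ` is `φ ⊗ id`. It kills the columns in `S` and sends `a_i ⊗ b_l` to a nonzero multiple of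
  -- `b_l`, so rank-nullity gives the bound; the increment of the rank of `A` is at most 1.
  let Φ : (ι × ι' → ℂ) →ₗ[ℂ] (ι' → ℂ) :=
    { toFun := fun v q => φ fun p => v (p, q)
      map_add' := fun v w => by ext q; exact map_add φ (fun p => v (p, q)) fun p => w (p, q)
      map_smul' := fun c v => by ext q; exact map_smul φ c fun p => v (p, q) }
  have hΦ : ∀ j l, Φ ((A ⊗ₖ B).col (j, l)) = φ (A.col j) • B.col l := by
    intro j l
    ext q
    have : (fun p => (A ⊗ₖ B).col (j, l) (p, q)) = B q l • A.col j := by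
      ext p
      simp [Matrix.col, mul_comm]
    change φ (fun p => (A ⊗ₖ B).col (j, l) (p, q)) = _
    rw [this, map_smul]
    simp [Matrix.col, mul_comm]
  have hker : colSpan (A ⊗ₖ B) S ≤ LinearMap.ker Φ := by
    refine Submodule.span_le.2 ?_
    rintro _ ⟨⟨j, l⟩, hjl, rfl⟩
    have : φ (A.col j) = 0 := hφs (Submodule.subset_span ⟨j, hS _ hjl, rfl⟩)
    simp [hΦ, this]
  set W := colSpan (A ⊗ₖ B) (S ∪ {i} ×ˢ J)
  have himg : colSpan B J ≤ LinearMap.range (Φ.domRestrict W) := by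
    refine Submodule.span_le.2 ?_
    rintro _ ⟨l, hl, rfl⟩
    refine ⟨(φ (A.col i))⁻¹ • ⟨(A ⊗ₖ B).col (i, l), Submodule.subset_span
      ⟨(i, l), Or.inr ⟨rfl, hl⟩, rfl⟩⟩, ?_⟩
    rw [map_smul, LinearMap.domRestrict_apply, hΦ, smul_smul, inv_mul_cancel₀ hφ, one_smul]
  have hker' : finrank ℂ (colSpan (A ⊗ₖ B) S) ≤ finrank ℂ (LinearMap.ker (Φ.domRestrict W)) := by
    rw [← (Submodule.comapSubtypeEquivOfLe hle).finrank_eq]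
    refine Submodule.finrank_mono fun x hx => ?_
    exact hker hx
  have hrn := LinearMap.finrank_range_add_finrank_ker (Φ.domRestrict W)
  have himg' := Submodule.finrank_mono himg
  have h2 : (finrank ℂ (colSpan A (insert i s)) - finrank ℂ (colSpan A s)) *
      finrank ℂ (colSpan B J) ≤ 1 * finrank ℂ (colSpan B J) := by
    gcongr; omega
  omega

end Kronecker

/-- The rank of a nonempty set of columns is at least the bound at the threshold `d`. -/
lemma bound_max_le_finrank_colSpan {ι κ : Type*} [Fintype ι] [Fintype κ] (M : Matrix ι κ ℂ)
    {σ : ℝ → ℝ} {d n : ℝ} (hn : (Fintype.card κ : ℝ) = n) (p : IsProfile n d σ) (hd : σ d ≤ 1)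
    (h : IsRankExpansionLowerBoundOn M (Icc 0 n) σ) {s : Finset κ} (hs : s.Nonempty) :
    σ (max s.card d) ≤ finrank ℂ (colSpan M (s : Set κ)) := by
  have hc : (1 : ℝ) ≤ s.card := by exact_mod_cast hs.card_pos
  have hcn : (s.card : ℝ) ≤ n := hn ▸ by exact_mod_cast s.card_le_univ
  have h1 : σ s.card ≤ finrank ℂ (colSpan M (s : Set κ)) :=
    (h.le_rankExpansion s.card hs.card_pos s.card_le_univ ⟨by linarith, hcn⟩).trans
      (by exact_mod_cast rankExpansion_le_finrank_colSpan M s)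
  rcases le_total d s.card with hds | hds
  · rwa [max_eq_left hds]
  rw [max_eq_right hds]
  -- A positive rank is at least `1 ≥ σ d`. If the rank is zero, then `σ s.card ≤ 0`, and concavity
  -- on the segment from `0` to `d` forces `σ d ≤ 0`.
  rcases Nat.eq_zero_or_pos (finrank ℂ (colSpan M (s : Set κ))) with h0 | h0
  · rw [h0, Nat.cast_zero] at h1 ⊢
    have hd0 : 0 < d := by linarith
    have h2 := p.concave.2 (left_mem_Icc.2 p.n_nonneg) (show d ∈ Icc 0 n from ⟨hd0.le, p.d_le⟩)
      (sub_nonneg.2 ((div_le_one hd0).2 hds)) (div_nonneg (zero_le_one.trans hc) hd0.le)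
      (sub_add_cancel 1 _)
    simp only [smul_eq_mul, mul_zero, zero_add, p.zero, div_mul_cancel₀ _ hd0.ne'] at h2
    have : 0 < (s.card : ℝ) / d := by positivity
    nlinarith
  · exact hd.trans (by exact_mod_cast h0)

/-! ### From a set of columns to a staircase. -/

section Sorted

variable {n n' : ℕ} {ι ι' : Type*} [Fintype ι] [Fintype ι']

/-- The first `t` indices in the order given by the permutation `τ`. -/
def firstIndices (τ : Equiv.Perm (Fin n)) (t : ℕ) : Finset (Fin n) :=
  Finset.univ.filter fun i => ((τ.symm i : Fin n) : ℕ) < t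

/-- The second components of the pairs in `S` whose first component has position `t` in the order
given by the permutation `τ`. -/
def fiberAt (τ : Equiv.Perm (Fin n)) (S : Finset (Fin n × Fin n')) (t : ℕ) : Finset (Fin n') :=
  Finset.univ.filter fun j => ∃ h : t < n, (τ ⟨t, h⟩, j) ∈ S

lemma card_firstIndices (τ : Equiv.Perm (Fin n)) {t : ℕ} (ht : t ≤ n) :
    (firstIndices τ t).card = t := by
  have : firstIndices τ t = (Finset.univ.filter fun i : Fin n => (i : ℕ) < t).map τ.toEmbedding := by
    ext i
    simp [firstIndices]
  rw [this, Finset.card_map, Fin.card_filter_val_lt, min_eq_right ht]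

lemma coe_firstIndices_succ (τ : Equiv.Perm (Fin n)) {t : ℕ} (ht : t < n) :
    (firstIndices τ (t + 1) : Set (Fin n)) = insert (τ ⟨t, ht⟩) (firstIndices τ t : Set (Fin n)) := by
  ext i
  have : i = τ ⟨t, ht⟩ ↔ ((τ.symm i : Fin n) : ℕ) = t := by
    rw [← Equiv.symm_apply_eq, Fin.ext_iff]
  simp only [firstIndices, Finset.coe_filter, Finset.mem_univ, true_and, Set.mem_ofPred_eq,
    mem_insert_iff, this]
  omega

/-- The columns of `A` are added one at a time in the order `τ`, each with its fibre in `S`, and the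
one-column estimate is summed. -/
lemma sum_rank_increments_mul_le (A : Matrix ι (Fin n) ℂ) (B : Matrix ι' (Fin n') ℂ)
    (τ : Equiv.Perm (Fin n)) (S : Finset (Fin n × Fin n')) {T : ℕ} (hT : T ≤ n) :
    ∑ t ∈ Finset.range T, (finrank ℂ (colSpan A (firstIndices τ (t + 1) : Set (Fin n))) -
        finrank ℂ (colSpan A (firstIndices τ t : Set (Fin n)))) *
          finrank ℂ (colSpan B (fiberAt τ S t : Set (Fin n'))) ≤
      finrank ℂ (colSpan (A ⊗ₖ B) {p | p ∈ S ∧ p.1 ∈ firstIndices τ T}) := by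
  induction T with
  | zero => simp
  | succ t ih =>
    rw [Finset.sum_range_succ]
    refine (Nat.add_le_add_right (ih (by omega)) _).trans ?_
    rw [coe_firstIndices_succ τ hT]
    refine (finrank_colSpan_kronecker_step A B _ _ _ _ fun p hp => hp.2).trans ?_
    refine Submodule.finrank_mono (Submodule.span_mono (image_mono ?_))
    rintro ⟨i, j⟩ (⟨h1, h2⟩ | ⟨rfl, h2⟩)
    · refine ⟨h1, ?_⟩
      rw [← Finset.mem_coe, coe_firstIndices_succ τ hT]
      exact mem_insert_of_mem _ h2
    · have h3 : (τ ⟨t, hT⟩, j) ∈ S := by simpa [fiberAt, Nat.lt_of_succ_le hT] using h2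
      refine ⟨h3, ?_⟩
      rw [← Finset.mem_coe, coe_firstIndices_succ τ hT]
      exact mem_insert _ _

lemma sum_card_fiberAt (τ : Equiv.Perm (Fin n)) (S : Finset (Fin n × Fin n')) :
    ∑ t ∈ Finset.range n, (fiberAt τ S t).card = S.card := by
  rw [Finset.sum_range, Finset.card_eq_sum_card_fiberwise (f := Prod.fst) (t := Finset.univ)
    (by intro x _; simp)]
  refine Eq.trans ?_ (Equiv.sum_comp τ _)
  refine Finset.sum_congr rfl fun t _ => ?_
  refine Finset.card_bij (fun j _ => (τ t, j)) ?_ ?_ ?_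
  · intro j hj; simpa [fiberAt] using hj
  · intro j _ l _ h; exact congrArg Prod.snd h
  · rintro ⟨i, j⟩ h
    obtain ⟨h1, rfl⟩ := Finset.mem_filter.1 h
    exact ⟨j, by simpa [fiberAt] using h1, rfl⟩

lemma exists_perm_fiberAt_antitone (S : Finset (Fin n × Fin n')) :
    ∃ τ : Equiv.Perm (Fin n), ∀ t, (fiberAt τ S (t + 1)).card ≤ (fiberAt τ S t).card := by
  classical
  -- The sign turns the increasing sort into an order of decreasing fibre size.
  let f : Fin n → ℤ := fun i => -((Finset.univ.filter fun j => (i, j) ∈ S).card : ℤ)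
  refine ⟨Tuple.sort f, fun t => ?_⟩
  by_cases h : t + 1 < n
  · have := Tuple.monotone_sort f (a := ⟨t, by omega⟩) (b := ⟨t + 1, h⟩) (by simp)
    have ht : t < n := by omega
    simpa [f, fiberAt, h, ht] using this
  · simp [fiberAt, h]

/-- The rank of a nonempty set of columns of `A ⊗ B` lies above the rectangle bound, or above both
the L-shaped bound and the larger one of the two ranks. -/
lemma rect_or_lShape_le_finrank (A : Matrix ι (Fin n) ℂ) (B : Matrix ι' (Fin n') ℂ)
    {σ τ : ℝ → ℝ} {d d' : ℝ} (hA : IsRankExpansionLowerBoundOn A (Icc (0 : ℝ) n) σ)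
    (hB : IsRankExpansionLowerBoundOn B (Icc (0 : ℝ) n') τ) (pA : IsProfile n d σ)
    (pB : IsProfile n' d' τ) (hd : σ d ≤ 1) (hd' : τ d' ≤ 1) (S : Finset (Fin n × Fin n'))
    (hS : S.Nonempty) :
    RectBelow n d σ n' d' τ S.card (finrank ℂ (colSpan (A ⊗ₖ B) (S : Set (Fin n × Fin n')))) ∨
      LShapeBelow n σ n' τ S.card (finrank ℂ (colSpan (A ⊗ₖ B) (S : Set (Fin n × Fin n')))) ∧
        max (σ n) (τ n') ≤ finrank ℂ (colSpan (A ⊗ₖ B) (S : Set (Fin n × Fin n'))) := by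
  classical
  obtain ⟨π, hπ⟩ := exists_perm_fiberAt_antitone S
  have hanti : Antitone fun t => (fiberAt π S t).card := antitone_nat_of_succ_le hπ
  have hsum := sum_card_fiberAt π S
  have hex : ∃ t, (fiberAt π S t).card = 0 := ⟨n, by simp [fiberAt]⟩
  -- Exactly the fibres `0, …, T` are nonempty. Cutting off the others is necessary: only a nonempty
  -- fibre may be enlarged to the threshold `d'`.
  obtain ⟨T, hT⟩ : ∃ T, Nat.find hex = T + 1 := by
    refine Nat.exists_eq_succ_of_ne_zero fun h0 => ?_
    have h1 := Nat.find_spec hex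
    rw [h0] at h1
    rw [Finset.sum_eq_zero fun t _ => Nat.le_zero.1 ((hanti (Nat.zero_le t)).trans h1.le)] at hsum
    exact hS.card_pos.ne hsum
  have hTn : T + 1 ≤ n := hT ▸ Nat.find_min' hex (by simp [fiberAt])
  have hT0 : (fiberAt π S (T + 1)).card = 0 := hT ▸ Nat.find_spec hex
  have hpos : ∀ t ≤ T, (fiberAt π S t).Nonempty := fun t ht =>
    Finset.card_ne_zero.1 (Nat.find_min hex (by omega))
  rw [← Finset.sum_range_add_sum_Ico _ hTn, Finset.sum_eq_zero (s := Finset.Ico _ _) fun t ht =>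
    Nat.le_zero.1 ((hanti (Finset.mem_Ico.1 ht).1).trans hT0.le), add_zero] at hsum
  -- Widths and heights are raised to the thresholds, except that `x 0 = 0`, so the first step has
  -- width `max 1 d`.
  set x : ℕ → ℝ := fun t => if t = 0 then 0 else max t d with hx
  set y : ℕ → ℝ := fun t => max (fiberAt π S t).card d' with hy
  have hxs : ∀ t, x (t + 1) = max ((t : ℝ) + 1) d := fun t => by simp [hx]
  have hx0 : x 0 = 0 := by simp [hx]
  have hxle : ∀ t, x t ≤ x (t + 1) := by
    rintro (_ | t)
    · rw [hx0, hxs]; exact le_max_of_le_right pA.d_nonneg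
    · rw [hxs, hxs]; push_cast; exact max_le_max (by linarith) le_rfl
  have hTn' : (T : ℝ) + 1 ≤ n := by exact_mod_cast hTn
  have hxn : x (T + 1) ≤ n := by rw [hxs]; exact max_le hTn' pA.d_le
  have hyle : ∀ t, y (t + 1) ≤ y t := fun t => max_le_max (by exact_mod_cast hπ t) le_rfl
  have hyn : ∀ t, y t ≤ n' := fun t =>
    max_le (by exact_mod_cast (Finset.card_le_univ _).trans (by simp)) pB.d_le
  have hyd : ∀ t, d' ≤ y t := fun t => le_max_right _ _
  obtain ⟨x₁, x₂, y₁, y₂, h1, h2, h3, h4, h5, h6, h7, h8⟩ := exists_three_steps pA pB x y hx0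
    (by rw [hxs]; exact le_max_right _ _) T (fun t _ => hxle t) hxn (fun t _ => hyle t) (hyn 0) d'
    pB.d_nonneg (hyd T)
  have harea : (S.card : ℝ) ≤ staircase id id x₁ x₂ (x (T + 1)) y₁ y₂ d' := by
    rw [h7, ← hsum]
    push_cast
    -- Unit-width steps with the raised heights already cover the area of `S`; since `t ≤ x t`,
    -- widening them only adds area.
    refine le_trans (Finset.sum_le_sum fun t _ => ?_) (sum_increments_mul_le (g := fun t => t) T
      (by simp [hx0]) ?_ (fun t _ => hyle t) (pB.d_nonneg.trans (hyd T)))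
    · simp [hy]
    · rintro (_ | t) ht _
      · omega
      · rw [hxs]; push_cast; exact le_max_left _ _
  have hval : staircase σ τ x₁ x₂ (x (T + 1)) y₁ y₂ d' ≤
      finrank ℂ (colSpan (A ⊗ₖ B) (S : Set (Fin n × Fin n'))) := by
    refine h8.trans ?_
    have hyτ : ∀ t ≤ T, τ (y t) ≤ finrank ℂ (colSpan B (fiberAt π S t : Set (Fin n'))) :=
      fun t ht => bound_max_le_finrank_colSpan B (by simp) pB hd' hB (hpos t ht)
    have hmono : ∀ t < n, finrank ℂ (colSpan A (firstIndices π t : Set (Fin n))) ≤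
        finrank ℂ (colSpan A (firstIndices π (t + 1) : Set (Fin n))) := fun t ht =>
      Submodule.finrank_mono (Submodule.span_mono (image_mono (by
        rw [coe_firstIndices_succ π ht]; exact subset_insert _ _)))
    refine (sum_increments_mul_le (g := fun t => σ (x t)) (c := fun t => τ (y t))
      (f := fun t => (finrank ℂ (colSpan A (firstIndices π t : Set (Fin n))) : ℝ)) T ?_ ?_
      (fun t _ => pB.le (pB.d_nonneg.trans (hyd _)) (hyle t) (hyn t))
      (pB.nonneg (pB.d_nonneg.trans (hyd _)) (hyn T))).trans ?_
    · have h0 : firstIndices π 0 = ∅ := Finset.card_eq_zero.1 (card_firstIndices π (Nat.zero_le n))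
      have h0' : colSpan A (firstIndices π 0 : Set (Fin n)) = ⊥ := by
        rw [h0, colSpan, Finset.coe_empty, image_empty, Submodule.span_empty]
      simp only [hx0, pA.zero]
      rw [h0', finrank_bot, Nat.cast_zero]
    · rintro (_ | t) ht ht'
      · omega
      · have := bound_max_le_finrank_colSpan A (by simp) pA hd hA (s := firstIndices π (t + 1))
          (Finset.card_pos.1 (by rw [card_firstIndices π (by omega)]; omega))
        rw [card_firstIndices π (by omega)] at this
        simpa [hx] using this
    · have h9 := (sum_rank_increments_mul_le A B π S hTn).trans
        (Submodule.finrank_mono (Submodule.span_mono (image_mono (t := (S : Set (Fin n × Fin n')))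
          fun p hp => hp.1)))
      refine le_trans ?_ (Nat.cast_le.2 h9)
      push_cast
      refine Finset.sum_le_sum fun t ht => ?_
      have ht' := Finset.mem_range.1 ht
      rw [Nat.cast_sub (hmono t (by omega))]
      exact mul_le_mul_of_nonneg_left (hyτ t (by omega))
        (sub_nonneg.2 (Nat.cast_le.2 (hmono t (by omega))))
  exact (rect_or_lShape_and_max_le pA pB h1 h2 h3 hxn le_rfl h4 h5 h6).imp
    (fun h => h.mono harea hval) (fun h => ⟨h.1.mono harea hval, h.2.trans hval⟩)

end Sorted

/-! ### Constant extension and the main theorem. -/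

section Extension

lemma min_mem_Icc {N k : ℝ} (hN : 0 ≤ N) (hk : 0 ≤ k) : min k N ∈ Icc 0 N :=
  ⟨le_min hk hN, min_le_right _ _⟩

lemma continuousOn_constExtend {N : ℝ} (hN : 0 ≤ N) {f : ℝ → ℝ} (hf : ContinuousOn f (Icc 0 N)) :
    ContinuousOn (constExtend N f) (Ici 0) :=
  hf.comp (by fun_prop) fun _ hk => min_mem_Icc hN hk

lemma monotoneOn_constExtend {N : ℝ} (hN : 0 ≤ N) {f : ℝ → ℝ} (hf : MonotoneOn f (Icc 0 N)) :
    MonotoneOn (constExtend N f) (Ici 0) := fun _ hk _ hl hkl =>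
  hf (min_mem_Icc hN hk) (min_mem_Icc hN hl) (min_le_min_right _ hkl)

lemma constExtend_of_le {N k : ℝ} (f : ℝ → ℝ) (hk : k ≤ N) : constExtend N f k = f k := by
  rw [constExtend, min_eq_left hk]

end Extension

theorem mainTheorem11 (mA nA mB nB : ℕ)
    (A : Matrix (Fin mA) (Fin nA) ℂ) (B : Matrix (Fin mB) (Fin nB) ℂ)
    (σA σB : ℝ → ℝ)
    (hA : IsRankExpansionLowerBoundOn A (Icc (0 : ℝ) nA) σA)
    (hB : IsRankExpansionLowerBoundOn B (Icc (0 : ℝ) nB) σB)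
    (hAc : ConcaveOn ℝ (Icc (0 : ℝ) nA) σA) (hBc : ConcaveOn ℝ (Icc (0 : ℝ) nB) σB)
    (hA0 : σA 0 = 0) (hB0 : σB 0 = 0) :
    -- both minima exist for all `k ∈ [0, nA * nB]`
    (∀ k ∈ Icc (0 : ℝ) (nA * nB),
      IsLeast (rectValues nA nB σA σB k) (rectBound nA nB σA σB k) ∧
      IsLeast (lShapeValues nA nB σA σB k) (lShapeBound nA nB σA σB k)) ∧
    -- `min {L_C, R_C}` is a rank expansion lower bound for `A ⊗ B`
    IsRankExpansionLowerBoundOn (A ⊗ₖ B) (Ici 0)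
      (constExtend (nA * nB)
        (fun k => min (lShapeBound nA nB σA σB k) (rectBound nA nB σA σB k))) ∧
    -- `R_C` alone is one wherever `R_C(k) ≤ max {r_A, r_B}`
    IsRankExpansionLowerBoundOn (A ⊗ₖ B)
      {k : ℝ | 0 ≤ k ∧
        constExtend (nA * nB) (rectBound nA nB σA σB) k ≤ max (σA nA) (σB nB)}
      (constExtend (nA * nB) (rectBound nA nB σA σB)) := by
  have pA := isProfile_pseudoinverse hA.continuousOn hA.monotoneOn hAc hA0
  have pB := isProfile_pseudoinverse hB.continuousOn hB.monotoneOn hBc hB0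
  have hdA := (pseudoinverse_mem hA.continuousOn hA0).2
  have hdB := (pseudoinverse_mem hB.continuousOn hB0).2
  have hN : (0 : ℝ) ≤ nA * nB := by positivity
  have hR := fun k hk => isLeast_rectBound hA.continuousOn hB.continuousOn pA pB (k := k) hk
  have hL := fun k hk => isLeast_lShapeBound hA.continuousOn hB.continuousOn (k := k) hk
  have hRle := fun k v hk => rectBound_le_of_rectBelow hA.continuousOn hB.continuousOn pA pB
    (k := k) (v := v) hk
  have hLle := fun k v hk => lShapeBound_le_of_lShapeBelow hA.continuousOn hB.continuousOn pA pB
    (k := k) (v := v) hk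
  have hRc := continuousOn_rectBound hA.continuousOn hB.continuousOn pA pB
  have hLc := continuousOn_lShapeBound hA.continuousOn hB.continuousOn pA pB
  have hRm : MonotoneOn (rectBound nA nB σA σB) (Icc (0 : ℝ) (nA * nB)) := by
    intro k hk l hl hkl
    obtain ⟨x, hx, y, hy, h1, h2⟩ := (hR l hl).1
    exact hRle k _ hk ⟨x, hx, y, hy, hkl.trans h1, h2.ge⟩
  have hLm : MonotoneOn (lShapeBound nA nB σA σB) (Icc (0 : ℝ) (nA * nB)) := by
    intro k hk l hl hkl
    obtain ⟨x, hx, y, hy, h1, h2⟩ := (hL l hl).1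
    exact hLle k _ hk ⟨x, hx, y, hy, hkl.trans h1.ge, h2.ge⟩
  have hR0 : ∀ k ∈ Icc (0 : ℝ) (nA * nB), 0 ≤ rectBound nA nB σA σB k := by
    intro k hk
    obtain ⟨x, hx, y, hy, -, h2⟩ := (hR k hk).1
    rw [h2]
    exact mul_nonneg (pA.nonneg (pA.d_nonneg.trans hx.1) hx.2)
      (pB.nonneg (pB.d_nonneg.trans hy.1) hy.2)
  have hL0 : ∀ k ∈ Icc (0 : ℝ) (nA * nB), 0 ≤ lShapeBound nA nB σA σB k := by
    intro k hk
    obtain ⟨x, hx, y, hy, -, h2⟩ := (hL k hk).1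
    rw [h2]
    have e1 := mul_nonneg (pA.nonneg hx.1 hx.2) (sub_nonneg.2 (pB.le hy.1 hy.2 le_rfl))
    have e2 := mul_nonneg (pB.nonneg hy.1 hy.2) (pA.nonneg pA.n_nonneg le_rfl)
    linarith
  have hrank : ∀ k : ℕ, 1 ≤ k → k ≤ Fintype.card (Fin nA × Fin nB) →
      (k : ℝ) ∈ Icc (0 : ℝ) (nA * nB) ∧
      (rectBound nA nB σA σB k ≤ rankExpansion (A ⊗ₖ B) k ∨
        lShapeBound nA nB σA σB k ≤ rankExpansion (A ⊗ₖ B) k ∧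
          max (σA nA) (σB nB) ≤ rankExpansion (A ⊗ₖ B) k) := by
    intro k hk1 hk
    have hkN : (k : ℝ) ∈ Icc (0 : ℝ) (nA * nB) :=
      ⟨Nat.cast_nonneg k, by simp at hk; exact_mod_cast hk⟩
    obtain ⟨S, rfl, hS⟩ := exists_finset_rankExpansion_eq (A ⊗ₖ B) hk
    rw [hS]
    exact ⟨hkN, (rect_or_lShape_le_finrank A B hA hB pA pB hdA hdB S (Finset.card_pos.1 hk1)).imp
      (hRle _ _ hkN) (And.imp_left (hLle _ _ hkN))⟩
  refine ⟨fun k hk => ⟨hR k hk, hL k hk⟩, ⟨?_, ?_, ?_, ?_⟩, ⟨?_, ?_, ?_, ?_⟩⟩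
  · exact continuousOn_constExtend hN (ContinuousOn.inf hLc hRc)
  · intro k hk
    exact le_min (hL0 _ (min_mem_Icc hN hk)) (hR0 _ (min_mem_Icc hN hk))
  · exact monotoneOn_constExtend hN fun k hk l hl hkl =>
      min_le_min (hLm hk hl hkl) (hRm hk hl hkl)
  · intro k hk1 hk _
    obtain ⟨hkN, h⟩ := hrank k hk1 hk
    rw [constExtend_of_le _ hkN.2]
    rcases h with h | h
    · exact (min_le_right _ _).trans h
    · exact (min_le_left _ _).trans h.1
  · exact (continuousOn_constExtend hN hRc).mono fun k hk => hk.1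
  · exact fun k hk => hR0 _ (min_mem_Icc hN hk.1)
  · exact (monotoneOn_constExtend hN hRm).mono fun k hk => hk.1
  · intro k hk1 hk hkD
    obtain ⟨hkN, h⟩ := hrank k hk1 hk
    have hk2 := hkD.2
    rw [constExtend_of_le _ hkN.2] at hk2 ⊢
    rcases h with h | h
    · exact h
    · exact hk2.trans h.2
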